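/- Let $V=\coprod_{n\in\mathbb Z}V_{(n)}$, with $V_{(n)}=0$ for $n<0$, be an $\mathbb N$-graded vertex algebra over $\mathbb C$ with vacuum $\mathbf 1$ and vertex operators $Y(u,x)=\sum_{n\in\mathbb Z}u_nx^{-n-1}$; that is, a vertex algebra with $u_kV_{(n)}\subseteq V_{(m+n-k-1)}$ for $u\in V_{(m)}$. For homogeneous $u\in V_{(m)}$ write $\operatorname{wt}u=m$. Let $O(V)\subseteq V$ be the span of the elements $\operatorname{Res}_x x^nY((x+1)^{L(0)}u,x)v$ with $u,v\in V$, $n\le -2$, where $(x+1)^{L(0)}u=(x+1)^{\operatorname{wt}u}u$ for homogeneous $u$, and let $A(V)=V/O(V)$ be Zhu's algebra, with product induced by $u*v=\operatorname{Res}_x x^{-1}Y((x+1)^{L(0)}u,x)v$ and unit $\mathbf 1+O(V)$. Let $M$ be a (unital) $A(V)$-module with representation $\rho:A(V)\to\operatorname{End}M$. Let $T(V[t,t^{-1}])$ be the tensor algebra of $V\otimes\mathbb C[t,t^{-1}]$, and write $u(m)=u\otimes t^m$. Let $T(V[t,t^{-1}])$ act from the left on $T(V[t,t^{-1}])\otimes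 M$, graded by $\deg\big(u_1(m_1)\cdots u_k(m_k)w\big)=\sum_{i}(\operatorname{wt}u_i-m_i-1)$ for homogeneous $u_i\in V$ and $w\in M$. Let $o_t(u)=u(\operatorname{wt}u-1)$ for homogeneous $u$, extended linearly to $V$. Let $\mathcal I$ be the $T(V[t,t^{-1}])$-submodule of $T(V[t,t^{-1}])\otimes M$ generated by 1. $u(m)w$, for homogeneous $u\in V$, homogeneous $w\in T(V[t,t^{-1}])\otimes M$ and $m\in\mathbb Z$ with $\operatorname{wt}u-m-1+\deg w<0$; 2. $o_t(u)w-\rho(u+O(V))w$, for $u\in V$ and $w\in M$; 3. with $l=\operatorname{wt}u+\deg w$, $$u(p)v(q)w-\sum_{i=0}^{\operatorname{wt}v+\deg w-q-1}\ \sum_{j=0}^{l}\binom{p-l}{i}\binom{l}{j}\,(u_{p-l-i+j}v)(q+l+i-j)\,w,$$ for homogeneous $u,v\in V$, homogeneous $w\in T(V[t,t^{-1}])\otimes M$ and $p,q\in\mathbb Z$ with $\operatorname{wt}v+\deg w>q$ and $(\operatorname{wt}u-p-1)+(\operatorname{wt}v-q-1)+\deg w\ge 0$. Let $S_1(M)=(T(V[t,t^{-1}])\otimes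 M)/\mathcal I$ with the induced grading, and let $\mathcal J$ be the $T(V[t,t^{-1}])$-submodule of $S_1(M)$ generated by $$\operatorname{Res}_{x_0}\operatorname{Res}_{x_2}x_0^{p-l-i}x_2^{q+i}(x_0+x_2)^{l}\,Y_{S_1(M)}(Y(u,x_0)v,x_2)w=\sum_{j=0}^{l}\binom{l}{j}(u_{p-l-i+j}v)(q+i+l-j)\,w,\qquad l=\operatorname{wt}u+\deg w,$$ for homogeneous $u,v\in V$, homogeneous $w\in S_1(M)$, and $p,q,i\in\mathbb Z$ with $i\ge\operatorname{wt}v+\deg w-q$; here $Y_{S_1(M)}(u,x)=\sum_{m\in\mathbb Z}u(m)x^{-m-1}$. Then the canonical map $M\to S_1(M)$ is injective, and, when $M$ is identified with its image in $S_1(M)$, $$\mathcal J\cap M=0 .$$ -/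

import Mathlib

open scoped TensorProduct

noncomputable section

universe uV uM

/-- A vertex algebra over `ℂ`. Here `Y u` is the vertex operator `Y(u, x) : V → V((x))`; lower
truncation is built into the type `VertexOperator ℂ V` (Laurent series with values in `V`). The
component `uₙ` of `Y(u, x) = ∑ₙ uₙ x^(-n-1)` is `VertexOperator.ncoeff (Y u) n`. -/
structure VertexAlgebra (V : Type uV) [AddCommGroup V] [Module ℂ V] where
  /-- the vertex operator map -/
  Y : V →ₗ[ℂ] VertexOperator ℂ V
  /-- the vacuum vector -/
  vac : V
  /-- vacuum property `Y(𝟏, x) = 1` -/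
  vac_ncoeff : ∀ (n : ℤ) (v : V), VertexOperator.ncoeff (Y vac) n v = if n = -1 then v else 0
  /-- creation property: `Y(u, x)𝟏` has no pole ... -/
  ncoeff_vac : ∀ (u : V) (n : ℤ), 0 ≤ n → VertexOperator.ncoeff (Y u) n vac = 0
  /-- ... and its constant term is `u` -/
  ncoeff_neg_one_vac : ∀ u : V, VertexOperator.ncoeff (Y u) (-1) vac = u
  /-- the Jacobi identity, in components (the coefficient extracted by
  `Res_{x₀} Res_{x₁} Res_{x₂} x₀^l x₁^m x₂^n`); by lower truncation all three sums are finite -/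
  jacobi : ∀ (u v w : V) (l m n : ℤ),
    (∑ᶠ i : ℕ, Ring.choose m i •
      VertexOperator.ncoeff (Y (VertexOperator.ncoeff (Y u) (l + i) v)) (m + n - i) w)
    = (∑ᶠ i : ℕ, ((-1 : ℤ) ^ i * Ring.choose l i) •
        VertexOperator.ncoeff (Y u) (m + l - i) (VertexOperator.ncoeff (Y v) (n + i) w))
      - (l.negOnePow : ℤ) • ∑ᶠ i : ℕ, ((-1 : ℤ) ^ i * Ring.choose l i) •
        VertexOperator.ncoeff (Y v) (n + l - i) (VertexOperator.ncoeff (Y u) (m + i) w)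

/-- The component `uₙ v` as a bilinear map in `u` and `v`. -/
def VertexAlgebra.mode {V : Type uV} [AddCommGroup V] [Module ℂ V] (A : VertexAlgebra V) (n : ℤ) :
    V →ₗ[ℂ] V →ₗ[ℂ] V where
  toFun u := VertexOperator.ncoeff (A.Y u) n
  map_add' u v := by rw [map_add, map_add]; rfl
  map_smul' c u := by rw [map_smul, map_smul]; rfl

/-- An `ℕ`-graded vertex algebra: a vertex algebra `V = ∐_{n ∈ ℤ} V₍ₙ₎` with `V₍ₙ₎ = 0` for `n < 0`
such that `[d, Y(u, x)] = x (d/dx) Y(u, x) + Y(d u, x)`, where `d` is multiplication by `n` on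
`V₍ₙ₎`; the commutator condition says that `u_k` maps `V₍ₙ₎` to `V₍ₘ₊ₙ₋ₖ₋₁₎` for `u ∈ V₍ₘ₎`. -/
structure NGradedVertexAlgebra (V : Type uV) [AddCommGroup V] [Module ℂ V] extends
    VertexAlgebra V where
  /-- the subspace of vectors of weight `n` -/
  gr : ℤ → Submodule ℂ V
  isInternal : DirectSum.IsInternal gr
  gr_neg : ∀ n : ℤ, n < 0 → gr n = ⊥
  ncoeff_mem : ∀ (m n k : ℤ) (u v : V), u ∈ gr m → v ∈ gr n →
    VertexOperator.ncoeff (Y u) k v ∈ gr (m + n - k - 1)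

namespace NGradedVertexAlgebra

variable {V : Type uV} [AddCommGroup V] [Module ℂ V] (A : NGradedVertexAlgebra V)

/-- The decomposition of `V` into its homogeneous components. -/
def decomp : V ≃ₗ[ℂ] DirectSum ℤ fun n => A.gr n :=
  (LinearEquiv.ofBijective (DirectSum.coeLinearMap A.gr)
    (show Function.Bijective (DirectSum.coeLinearMap A.gr) from A.isInternal)).symm

/-- The linear map on `V` that is `f n` on the vectors of weight `n`. -/
def extend {E : Type*} [AddCommGroup E] [Module ℂ E] (f : ℤ → V →ₗ[ℂ] E) : V →ₗ[ℂ] E :=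
  DirectSum.toModule ℂ ℤ E (fun n => f n ∘ₗ (A.gr n).subtype) ∘ₗ A.decomp.toLinearMap

theorem extend_of_mem {E : Type*} [AddCommGroup E] [Module ℂ E] (f : ℤ → V →ₗ[ℂ] E) {n : ℤ}
    {u : V} (hu : u ∈ A.gr n) : A.extend f u = f n u := by
  have h : A.decomp u = DirectSum.lof ℂ ℤ (fun n => A.gr n) n ⟨u, hu⟩ := by
    rw [decomp, LinearEquiv.symm_apply_eq, LinearEquiv.ofBijective_apply,
      DirectSum.coeLinearMap_lof]
  rw [extend, LinearMap.comp_apply, LinearEquiv.coe_coe, h, DirectSum.toModule_lof]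
  rfl

/-- `Res_x x^n Y((x + 1)^{L(0)} u, x) v`, linear in `u` and `v`: for `u` of weight `m` it equals
`∑_{j=0}^{m} (m choose j) u_{n+j} v`. -/
def zhuRes (n : ℤ) : V →ₗ[ℂ] V →ₗ[ℂ] V :=
  A.extend fun m => ∑ j ∈ Finset.range (m + 1).toNat, Ring.choose m j • A.mode (n + j)

/-- The subspace `O(V)`. -/
def zhuO : Submodule ℂ V :=
  Submodule.span ℂ {x | ∃ (u v : V) (n : ℤ), n ≤ -2 ∧ x = A.zhuRes n u v}

/-- The space `A(V) = V / O(V)` underlying Zhu's algebra. -/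
abbrev ZhuAlgebra : Type uV := V ⧸ A.zhuO

/-- Zhu's product `u * v = Res_x x⁻¹ Y((x + 1)^{L(0)} u, x) v`, on representatives in `V`. -/
def zhuMul (u v : V) : V := A.zhuRes (-1) u v

/-- An `A(V)`-module structure on the vector space `M`: a representation `ρ : A(V) → End M` of the
unital associative algebra `A(V)`, whose product is induced by `*` and whose unit is the class of
the vacuum. -/
structure ZhuModule (M : Type uM) [AddCommGroup M] [Module ℂ M] where
  ρ : A.ZhuAlgebra →ₗ[ℂ] Module.End ℂ M
  map_mul : ∀ u v : V, ρ (Submodule.Quotient.mk (A.zhuMul u v)) =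
    ρ (Submodule.Quotient.mk u) * ρ (Submodule.Quotient.mk v)
  map_one : ρ (Submodule.Quotient.mk A.vac) = 1

end NGradedVertexAlgebra

/-- The tensor algebra `T(V[t, t⁻¹])` of the affinization `V[t, t⁻¹] = V ⊗ ℂ[t, t⁻¹]`. -/
abbrev AffTensor (V : Type uV) [AddCommGroup V] [Module ℂ V] : Type uV :=
  TensorAlgebra ℂ (V ⊗[ℂ] LaurentPolynomial ℂ)

/-- The generator `u(m) = u ⊗ t^m` of `T(V[t, t⁻¹])`, linear in `u`. -/
def affGen {V : Type uV} [AddCommGroup V] [Module ℂ V] (m : ℤ) : V →ₗ[ℂ] AffTensor V :=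
  TensorAlgebra.ι ℂ ∘ₗ
    (TensorProduct.mk ℂ V (LaurentPolynomial ℂ)).flip (LaurentPolynomial.T m)

namespace NGradedVertexAlgebra

variable {V : Type uV} [AddCommGroup V] [Module ℂ V] (A : NGradedVertexAlgebra V)

/-- `o_t(u) = u(wt u - 1)` for homogeneous `u`, extended linearly. -/
def oT : V →ₗ[ℂ] AffTensor V := A.extend fun n => affGen (n - 1)

/-- The operator `Res_{x₀} Res_{x₂} x₀^a x₂^b (x₀ + x₂)^l Y_t(Y(u, x₀)v, x₂)`, that is
`∑_{j=0}^{l} (l choose j) (u_{a+j} v)(b + l - j)`, as an element of `T(V[t, t⁻¹])`, for `l ≥ 0`.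
(It is `0` for `l < 0`. Such an `l` occurs below only when the vector acted upon has negative
degree; then that vector itself is already one of the relations.) -/
def iterRes (a b l : ℤ) (u v : V) : AffTensor V :=
  ∑ j ∈ Finset.range (l + 1).toNat,
    Ring.choose l j • affGen (b + l - j) (A.mode (a + j) u v)

section

variable (M : Type uM) [AddCommGroup M] [Module ℂ M]

/-- The monomials `u₁(m₁)⋯u_k(m_k)w` with homogeneous `uᵢ ∈ V` and `w ∈ M`, together with their
degrees `(wt u₁ - m₁ - 1) + ⋯ + (wt u_k - m_k - 1)`. -/
inductive IsMonomial : ℤ → (AffTensor V ⊗[ℂ] M) → Prop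
  | base (w : M) : IsMonomial 0 (1 ⊗ₜ[ℂ] w)
  | cons (d k m : ℤ) (u : V) (x : AffTensor V ⊗[ℂ] M) : u ∈ A.gr k → IsMonomial d x →
      IsMonomial (k - m - 1 + d) (affGen m u • x)

/-- The space of homogeneous elements of degree `d` of `T(V[t, t⁻¹]) ⊗ M`. -/
def degPart (d : ℤ) : Submodule ℂ (AffTensor V ⊗[ℂ] M) :=
  Submodule.span ℂ {x | A.IsMonomial M d x}

/-- The truncation relations: `u(m)w` with `wt u - m - 1 + deg w < 0`. -/
def truncRel : Set (AffTensor V ⊗[ℂ] M) :=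
  {x | ∃ (a d m : ℤ) (u : V) (w : AffTensor V ⊗[ℂ] M), u ∈ A.gr a ∧ w ∈ A.degPart M d ∧
    a - m - 1 + d < 0 ∧ x = affGen m u • w}

/-- The product formula relations
`u(p)v(q)w - ∑_{i=0}^{wt v + deg w - q - 1} (p - l choose i)
  Res_{x₀} Res_{x₂} x₀^{p-l-i} x₂^{q+i} (x₀ + x₂)^l Y_t(Y(u, x₀)v, x₂)w`, where
`l = wt u + deg w`. -/
def prodRel : Set (AffTensor V ⊗[ℂ] M) :=
  {x | ∃ (a b d p q : ℤ) (u v : V) (w : AffTensor V ⊗[ℂ] M),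
    u ∈ A.gr a ∧ v ∈ A.gr b ∧ w ∈ A.degPart M d ∧
    q < b + d ∧ 0 ≤ (a - p - 1) + (b - q - 1) + d ∧
    x = affGen p u • affGen q v • w -
      ∑ i ∈ Finset.range (b + d - q).toNat,
        Ring.choose (p - (a + d)) i •
          (A.iterRes (p - (a + d) - i) (q + i) (a + d) u v • w)}

end

section

variable {A} {M : Type uM} [AddCommGroup M] [Module ℂ M] (N : A.ZhuModule M)

/-- The relations `o_t(u)w - ρ(u + O(V))w` for `u ∈ V`, `w ∈ M`. -/
def zhuRel : Set (AffTensor V ⊗[ℂ] M) :=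
  {x | ∃ (u : V) (w : M),
    x = A.oT u • ((1 : AffTensor V) ⊗ₜ[ℂ] w) - 1 ⊗ₜ[ℂ] (N.ρ (Submodule.Quotient.mk u) w)}

/-- The submodule `ℐ` of `T(V[t, t⁻¹]) ⊗ M`. -/
def submoduleI : Submodule (AffTensor V) (AffTensor V ⊗[ℂ] M) :=
  Submodule.span (AffTensor V) (A.truncRel M ∪ zhuRel N ∪ A.prodRel M)

/-- `S₁(M) = (T(V[t, t⁻¹]) ⊗ M) / ℐ`. -/
abbrev S₁ : Type max uV uM := (AffTensor V ⊗[ℂ] M) ⧸ submoduleI N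

/-- The canonical map `M → S₁(M)`. -/
def toS₁ (w : M) : S₁ N := Submodule.Quotient.mk ((1 : AffTensor V) ⊗ₜ[ℂ] w)

/-- The submodule `𝒥` of `S₁(M)` generated by
`Res_{x₀} Res_{x₂} x₀^{p-l-i} x₂^{q+i} (x₀ + x₂)^l Y(Y(u, x₀)v, x₂)w`, `l = wt u + deg w`,
for homogeneous `u, v ∈ V`, homogeneous `w ∈ S₁(M)` and `i ≥ wt v + deg w - q`. The homogeneous
elements of `S₁(M)` are the classes of those of `T(V[t, t⁻¹]) ⊗ M`. -/
def submoduleJ : Submodule (AffTensor V) (S₁ N) :=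
  Submodule.span (AffTensor V)
    {x | ∃ (a b d p q i : ℤ) (u v : V) (w : AffTensor V ⊗[ℂ] M),
      u ∈ A.gr a ∧ v ∈ A.gr b ∧ w ∈ A.degPart M d ∧ b + d - q ≤ i ∧
      x = A.iterRes (p - (a + d) - i) (q + i) (a + d) u v •
        (Submodule.Quotient.mk w : S₁ N)}

end

end NGradedVertexAlgebra

end

/-! It suffices to find a graded module W over T(V[t, t⁻¹]) with a copy of M in degree zero, such
that the map T(V[t, t⁻¹]) ⊗ M → W kills the generators of both ℐ and 𝒥: an element of M that dies in
S₁(M), or lands in 𝒥, is then zero in W, hence zero.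

The commutator formula makes V[t, t⁻¹] a graded Leibniz algebra. It is not antisymmetric, since
total derivatives are not divided out, but its symmetrized brackets will act by zero. Its degree
zero part acts on M by u(wt u - 1) ↦ ρ(u). W should be the induced module modulo the largest
submodule missing M. This is built without PBW: the component M → M of the action of a word is
computed by moving lowering letters to the right until they reach M and die (`corr`), and
`corr_comm` shows that the result respects the bracket. A vector of W is then the function l ↦
`corr` (l ++ Y) w, so a vector all of whose components in M, after any word, vanish is zero.

This nondegeneracy yields the Jacobi identity on W (`jacobiOp_eq_zero`), by induction on the
exponent a of x₀. For a = 0 it is the commutator formula, and larger a follow formally. For a < 0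
the defects at exponent a span a space stable under commutators with V[t, t⁻¹], so
`eq_zero_of_ad_stable` leaves only their components M → M. Since the defects at a + 1 vanish, those
at a depend on m and n only through m + n. Taking m = wt u turns the iterate into Res x^a Y((1 +
x)^{L(0)} u, x)v, which acts by zero for a ≤ -2 by the definition of O(V), and by ρ(u)ρ(v) for a =
-1 by the definition of Zhu's product.

Finally, for l = wt u + deg w the products with u on the right vanish on w, so the iterates in the
relations are finite sums of products u(·)v(·)w (`act_iterLetter`). For the generators of 𝒥 this sum
is empty; for the product relations of ℐ everything but u(p)v(q)w cancels by the alternating sum of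
binomial coefficients. -/

noncomputable section

/-! ### Derivations acting on functions of words -/

section LetterDerivation

set_option linter.unusedSectionVars false

variable {L : Type*} [AddCommGroup L] [Module ℂ L] {X : Type*} [AddCommGroup X] [Module ℂ X]

/-- A function on words that is linear in every letter. -/
structure IsWordLinear (g : List L → X) : Prop where
  add : ∀ (l₁ l₂ : List L) (x y : L), g (l₁ ++ (x + y) :: l₂) = g (l₁ ++ x :: l₂) + g (l₁ ++ y :: l₂)
  smul : ∀ (l₁ l₂ : List L) (c : ℂ) (x : L), g (l₁ ++ (c • x) :: l₂) = c • g (l₁ ++ x :: l₂)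

namespace IsWordLinear

variable {g : List L → X} (hg : IsWordLinear g)
include hg

theorem append_left (l : List L) : IsWordLinear fun l' => g (l ++ l') :=
  ⟨fun l₁ l₂ x y => by simpa using hg.add (l ++ l₁) l₂ x y,
    fun l₁ l₂ c x => by simpa using hg.smul (l ++ l₁) l₂ c x⟩

theorem append_right (l : List L) : IsWordLinear fun l' => g (l' ++ l) :=
  ⟨fun l₁ l₂ x y => by simpa using hg.add l₁ (l₂ ++ l) x y,
    fun l₁ l₂ c x => by simpa using hg.smul l₁ (l₂ ++ l) c x⟩

theorem cons (a : L) : IsWordLinear fun l' => g (a :: l') := hg.append_left [a]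

theorem head_add (l : List L) (x y : L) : g ((x + y) :: l) = g (x :: l) + g (y :: l) :=
  hg.add [] l x y

theorem head_smul (l : List L) (c : ℂ) (x : L) : g ((c • x) :: l) = c • g (x :: l) :=
  hg.smul [] l c x

/-- The dependence on one letter, as a linear map. -/
def slot (l₁ l₂ : List L) : L →ₗ[ℂ] X where
  toFun x := g (l₁ ++ x :: l₂)
  map_add' := hg.add l₁ l₂
  map_smul' := hg.smul l₁ l₂

end IsWordLinear

/-- The sum of the values of `g` on the words obtained from a given one by applying
`br z` to one of its letters. -/
def derSum (br : L →ₗ[ℂ] L →ₗ[ℂ] L) (z : L) : List L → (List L → X) → X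
  | [], _ => 0
  | y :: l, g => g (br z y :: l) + derSum br z l fun l' => g (y :: l')

variable (br : L →ₗ[ℂ] L →ₗ[ℂ] L)

theorem derSum_nil (z : L) (g : List L → X) : derSum br z [] g = 0 := rfl

theorem derSum_cons (z y : L) (l : List L) (g : List L → X) :
    derSum br z (y :: l) g = g (br z y :: l) + derSum br z l fun l' => g (y :: l') := rfl

theorem derSum_congr (z : L) (l : List L) : ∀ {g g' : List L → X},
    (∀ l', l'.length = l.length → g l' = g' l') → derSum br z l g = derSum br z l g' := by
  induction l with
  | nil => intro g g' _; rfl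
  | cons y l ih =>
    intro g g' h
    rw [derSum_cons, derSum_cons, h _ (by simp), ih fun l' hl => h _ (by simp [hl])]

theorem map_derSum {X' : Type*} [AddCommGroup X'] [Module ℂ X'] (T : X →ₗ[ℂ] X') (z : L) (l : List L) :
    ∀ g : List L → X, derSum br z l (fun l' => T (g l')) = T (derSum br z l g) := by
  induction l with
  | nil => intro g; simp [derSum_nil]
  | cons y l ih => intro g; rw [derSum_cons, derSum_cons, map_add, ih fun l' => g (y :: l')]

theorem derSum_add (z : L) (l : List L) : ∀ g g' : List L → X,
    derSum br z l (fun l' => g l' + g' l') = derSum br z l g + derSum br z l g' := by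
  induction l with
  | nil => intro g g'; simp [derSum_nil]
  | cons y l ih =>
    intro g g'
    rw [derSum_cons, derSum_cons, derSum_cons, ih (fun l' => g (y :: l')) fun l' => g' (y :: l')]
    abel

theorem derSum_neg (z : L) (l : List L) (g : List L → X) :
    derSum br z l (fun l' => -g l') = -derSum br z l g :=
  map_derSum br (-LinearMap.id : X →ₗ[ℂ] X) z l g

theorem derSum_sub (z : L) (l : List L) (g g' : List L → X) :
    derSum br z l (fun l' => g l' - g' l') = derSum br z l g - derSum br z l g' := by
  simp only [sub_eq_add_neg, derSum_add, derSum_neg]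

theorem derSum_smul_fun (z : L) (l : List L) (c : ℂ) (g : List L → X) :
    derSum br z l (fun l' => c • g l') = c • derSum br z l g :=
  map_derSum br (LinearMap.lsmul ℂ X c : X →ₗ[ℂ] X) z l g

theorem derSum_append (z : L) (l₁ l₂ : List L) : ∀ g : List L → X,
    derSum br z (l₁ ++ l₂) g =
      derSum br z l₁ (fun l => g (l ++ l₂)) + derSum br z l₂ fun l => g (l₁ ++ l) := by
  induction l₁ with
  | nil => intro g; simp [derSum_nil]
  | cons y l ih =>
    intro g
    rw [List.cons_append, derSum_cons, derSum_cons, ih fun l' => g (y :: l')]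
    simp only [List.cons_append]
    abel

theorem derSum_eq_zero (z : L) (l : List L) {g : List L → X}
    (h : ∀ l', l'.length = l.length → g l' = 0) : derSum br z l g = 0 := by
  rw [derSum_congr br z l h]
  simpa using map_derSum br (0 : X →ₗ[ℂ] X) z l g

theorem derSum_add_left (x y : L) (l : List L) : ∀ {g : List L → X}, IsWordLinear g →
    derSum br (x + y) l g = derSum br x l g + derSum br y l g := by
  induction l with
  | nil => intro g _; simp [derSum_nil]
  | cons a l ih =>
    intro g hg
    rw [derSum_cons, derSum_cons, derSum_cons, ih (hg.cons a), map_add, LinearMap.add_apply,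
      hg.head_add]
    abel

theorem derSum_smul_left (c : ℂ) (x : L) (l : List L) : ∀ {g : List L → X}, IsWordLinear g →
    derSum br (c • x) l g = c • derSum br x l g := by
  induction l with
  | nil => intro g _; simp [derSum_nil]
  | cons a l ih =>
    intro g hg
    rw [derSum_cons, derSum_cons, ih (hg.cons a), map_smul, LinearMap.smul_apply,
      hg.head_smul, smul_add]

theorem IsWordLinear.derSum (z : L) {g : List L → X} (hg : IsWordLinear g) :
    IsWordLinear fun l => derSum br z l g := by
  constructor
  · intro l₁ l₂ x y
    simp only [derSum_append, derSum_cons, map_add, hg.add]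
    simp only [derSum_add]
    abel
  · intro l₁ l₂ c x
    simp only [derSum_append, derSum_cons, map_smul, hg.smul]
    simp only [derSum_smul_fun, smul_add]

/-- `br` is a derivation of itself, so `derSum` turns brackets into commutators. -/
theorem derSum_br (hbr : ∀ x y z, br x (br y z) = br (br x y) z + br y (br x z)) (x y : L)
    (l : List L) : ∀ {g : List L → X}, IsWordLinear g →
    derSum br (br x y) l g =
      derSum br y l (fun l' => derSum br x l' g) - derSum br x l (fun l' => derSum br y l' g) := by
  induction l with
  | nil => intro g _; simp [derSum_nil]
  | cons a l ih =>
    intro g hg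
    simp only [derSum_cons, ih (hg.cons a), derSum_add]
    have h := hbr x y a
    have h' : g (br x (br y a) :: l) = g (br (br x y) a :: l) + g (br y (br x a) :: l) := by
      rw [h, hg.head_add]
    rw [h']
    abel

end LetterDerivation

/-! ### Correlation functions of a graded Leibniz algebra -/

/-- A graded Leibniz algebra `L` with the projection `neg` to its part of negative degree and a
representation `rep` of its part of degree zero on `M`, which kills all symmetrized brackets. -/
structure TriangularLeibniz (L M : Type*) [AddCommGroup L] [Module ℂ L] [AddCommGroup M]
    [Module ℂ M] where
  br : L →ₗ[ℂ] L →ₗ[ℂ] L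
  gr : ℤ → Submodule ℂ L
  neg : L →ₗ[ℂ] L
  rep : L →ₗ[ℂ] Module.End ℂ M
  leibniz : ∀ x y z, br x (br y z) = br (br x y) z + br y (br x z)
  iSup_gr : ⨆ d, gr d = ⊤
  br_mem : ∀ {a b : ℤ} {x y : L}, x ∈ gr a → y ∈ gr b → br x y ∈ gr (a + b)
  neg_of_neg : ∀ {a : ℤ} {x : L}, x ∈ gr a → a < 0 → neg x = x
  neg_of_nonneg : ∀ {a : ℤ} {x : L}, x ∈ gr a → 0 ≤ a → neg x = 0
  rep_of_ne : ∀ {a : ℤ} {x : L}, x ∈ gr a → a ≠ 0 → rep x = 0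
  rep_symm : ∀ x y, rep (br x y + br y x) = 0
  rep_br : ∀ {x y : L}, x ∈ gr 0 → y ∈ gr 0 → rep (br x y) = rep x * rep y - rep y * rep x

namespace TriangularLeibniz

variable {L M : Type*} [AddCommGroup L] [Module ℂ L] [AddCommGroup M] [Module ℂ M]
  (S : TriangularLeibniz L M)

theorem gr_induction {p : L → Prop} (h : ∀ a, ∀ x ∈ S.gr a, p x)
    (h0 : p 0) (hadd : ∀ x y, p x → p y → p (x + y)) (x : L) : p x :=
  Submodule.iSup_induction S.gr (motive := p) (S.iSup_gr ▸ Submodule.mem_top) h h0 hadd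

/-- Two linear maps that agree on homogeneous letters are equal. -/
theorem hom_ext {X : Type*} [AddCommGroup X] [Module ℂ X] {f g : L →ₗ[ℂ] X}
    (h : ∀ a, ∀ x ∈ S.gr a, f x = g x) : f = g := by
  ext x
  induction x using S.gr_induction with
  | h a x hx => exact h a x hx
  | h0 => simp
  | hadd x y hx hy => simp [hx, hy]

/-- Correlation functions of words of length at most `n`. -/
def corrAux : ℕ → List L → Module.End ℂ M
  -- The first argument bounds the recursion, because the words inside `derSum` are not subwords.
  -- The value 0 on the next line is junk: `corr` uses the length as bound and never reaches it.
  | 0, [] => 1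
  | 0, _ :: _ => 0
  | _ + 1, [] => 1
  | n + 1, x :: l => S.rep x * corrAux n l + derSum S.br (S.neg x) l (corrAux n)

theorem isWordLinear_corrAux (n : ℕ) : IsWordLinear (S.corrAux n) := by
  induction n with
  | zero =>
    constructor
    · rintro (_ | ⟨a, l⟩) l₂ x y <;> simp [corrAux]
    · rintro (_ | ⟨a, l⟩) l₂ c x <;> simp [corrAux]
  | succ n ih =>
    constructor
    · rintro (_ | ⟨a, l⟩) l₂ x y
      · simp only [List.nil_append, corrAux, map_add, add_mul, derSum_add_left S.br _ _ l₂ ih]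
        abel
      · simp only [List.cons_append, corrAux, ih.add, (ih.derSum S.br (S.neg a)).add, mul_add]
        abel
    · rintro (_ | ⟨a, l⟩) l₂ c x
      · simp only [List.nil_append, corrAux, map_smul, derSum_smul_left S.br _ _ l₂ ih, smul_add,
          smul_mul_assoc]
      · simp only [List.cons_append, corrAux, ih.smul, (ih.derSum S.br (S.neg a)).smul, smul_add,
          mul_smul_comm]

/-- The correlation function of a word: the component `M → M` of its action on the induced
module, computed by moving lowering letters to the right. -/
def corr (l : List L) : Module.End ℂ M := S.corrAux l.length l

theorem corr_nil : S.corr [] = 1 := rfl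

theorem corr_cons (x : L) (l : List L) :
    S.corr (x :: l) = S.rep x * S.corr l + derSum S.br (S.neg x) l S.corr := by
  simp only [corr, List.length_cons, corrAux]
  rw [derSum_congr S.br (S.neg x) l fun l' h => ?_]
  rw [corr, h]

theorem isWordLinear_corr : IsWordLinear S.corr := by
  constructor
  · intro l₁ l₂ x y
    have := (S.isWordLinear_corrAux (l₁.length + (l₂.length + 1))).add l₁ l₂ x y
    simpa [corr] using this
  · intro l₁ l₂ c x
    have := (S.isWordLinear_corrAux (l₁.length + (l₂.length + 1))).smul l₁ l₂ c x
    simpa [corr] using this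

theorem corr_cons_of_neg {a : ℤ} {x : L} (hx : x ∈ S.gr a) (ha : a < 0) (l : List L) :
    S.corr (x :: l) = derSum S.br x l S.corr := by
  rw [corr_cons, S.rep_of_ne hx ha.ne, S.neg_of_neg hx ha, zero_mul, zero_add]

theorem corr_cons_of_nonneg {a : ℤ} {x : L} (hx : x ∈ S.gr a) (ha : 0 ≤ a) (l : List L) :
    S.corr (x :: l) = S.rep x * S.corr l := by
  rw [corr_cons, S.neg_of_nonneg hx ha, ← zero_smul ℂ (0 : L),
    derSum_smul_left S.br _ _ l S.isWordLinear_corr, zero_smul, add_zero]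

/-- A symmetrized bracket acts by zero. -/
theorem derSum_symm (x y : L) (l : List L) : derSum S.br (S.br x y + S.br y x) l S.corr = 0 := by
  rw [derSum_add_left S.br _ _ l S.isWordLinear_corr,
    derSum_br S.br S.leibniz x y l S.isWordLinear_corr,
    derSum_br S.br S.leibniz y x l S.isWordLinear_corr]
  abel

/-- In negative degree the two brackets act on the rest of the word as opposite commutators of
derivations; in nonnegative degree only `rep` is left, and it kills symmetrized brackets. -/
theorem corr_symm_cons (x y : L) (l : List L) : S.corr ((S.br x y + S.br y x) :: l) = 0 := by
  have key : ∀ a b, ∀ x ∈ S.gr a, ∀ y ∈ S.gr b, S.corr ((S.br x y + S.br y x) :: l) = 0 := by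
    intro a b x hx y hy
    have hk : S.br x y + S.br y x ∈ S.gr (a + b) :=
      add_mem (S.br_mem hx hy) (add_comm b a ▸ S.br_mem hy hx)
    rcases lt_or_ge (a + b) 0 with h | h
    · rw [S.corr_cons_of_neg hk h, derSum_symm]
    · rw [S.corr_cons_of_nonneg hk h, S.rep_symm, zero_mul]
  have h0 : S.corr ((0 : L) :: l) = 0 := by
    simpa using S.isWordLinear_corr.head_smul l 0 0
  induction x using S.gr_induction with
  | h a x hx =>
    induction y using S.gr_induction with
    | h b y hy => exact key a b x hx y hy
    | h0 => simpa using h0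
    | hadd y y' h h' =>
      rw [map_add, map_add, LinearMap.add_apply, add_add_add_comm, S.isWordLinear_corr.head_add, h,
        h', add_zero]
  | h0 => simpa using h0
  | hadd x x' h h' =>
    rw [map_add, map_add, LinearMap.add_apply, add_add_add_comm, S.isWordLinear_corr.head_add, h,
      h', add_zero]

theorem corr_append_symm (l₁ : List L) : ∀ (x y : L) (l₂ : List L),
    S.corr (l₁ ++ (S.br x y + S.br y x) :: l₂) = 0 := by
  induction h : l₁.length generalizing l₁ with
  | zero => rw [List.length_eq_zero_iff.1 h]; exact S.corr_symm_cons
  | succ n ih =>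
    obtain ⟨z, l, rfl⟩ := List.exists_cons_of_length_eq_add_one h
    replace h : l.length = n := by simpa using h
    intro x y l₂
    rw [List.cons_append, corr_cons, ih l h, mul_zero, zero_add, derSum_append, derSum_cons,
      derSum_eq_zero S.br _ _ fun l' hl => ih l' (hl.trans h) x y l₂, zero_add,
      derSum_eq_zero S.br _ l₂ fun l' _ => ih l h x y l', add_zero, map_add,
      S.leibniz, S.leibniz _ y x]
    -- The derivation of a symmetrized bracket is regrouped into the symmetrized brackets of (zx, y)
    -- and of (x, zy).
    have : ∀ z, S.br (S.br z x) y + S.br x (S.br z y) + (S.br (S.br z y) x + S.br y (S.br z x)) =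
      (S.br (S.br z x) y + S.br y (S.br z x)) + (S.br x (S.br z y) + S.br (S.br z y) x) := by
      intro z; abel
    rw [this, S.isWordLinear_corr.add, ih l h, ih l h, add_zero]

theorem corr_br_swap (l₁ l₂ : List L) (x y : L) :
    S.corr (l₁ ++ S.br y x :: l₂) = -S.corr (l₁ ++ S.br x y :: l₂) := by
  have := S.corr_append_symm l₁ x y l₂
  rw [S.isWordLinear_corr.add] at this
  exact (neg_eq_of_add_eq_zero_right this).symm

/-- With a ≤ b three cases remain: both letters lowering, where `derSum_br` applies; only x
lowering, where the bracket is the first term of the derivation; neither lowering, where `rep_br` or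
a vanishing `rep` decides. -/
theorem corr_comm_cons_aux {a b : ℤ} {x y : L} (hx : x ∈ S.gr a) (hy : y ∈ S.gr b) (hab : a ≤ b)
    (l : List L) : S.corr (x :: y :: l) - S.corr (y :: x :: l) = S.corr (S.br x y :: l) := by
  have hxy := S.br_mem hx hy
  rcases lt_or_ge a 0 with ha | ha
  · rw [S.corr_cons_of_neg hx ha, derSum_cons]
    rcases lt_or_ge b 0 with hb | hb
    · have h1 : derSum S.br x l (fun l' => S.corr (y :: l')) =
          derSum S.br x l (fun l' => derSum S.br y l' S.corr) :=
        derSum_congr S.br x l fun l' _ => S.corr_cons_of_neg hy hb l'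
      have h2 : derSum S.br y l (fun l' => S.corr (x :: l')) =
          derSum S.br y l (fun l' => derSum S.br x l' S.corr) :=
        derSum_congr S.br y l fun l' _ => S.corr_cons_of_neg hx ha l'
      have h3 := S.corr_br_swap [] l x y
      have h4 := S.corr_cons_of_neg hxy (by omega) l
      rw [derSum_br S.br S.leibniz x y l S.isWordLinear_corr] at h4
      rw [S.corr_cons_of_neg hy hb, derSum_cons, h1, h2]
      simp only [List.nil_append] at h3
      rw [h3, h4]
      abel
    · have h1 : derSum S.br x l (fun l' => S.corr (y :: l')) =
          S.rep y * derSum S.br x l S.corr := by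
        rw [derSum_congr S.br x l fun l' _ => S.corr_cons_of_nonneg hy hb l']
        exact map_derSum S.br (LinearMap.mulLeft ℂ (S.rep y)) x l S.corr
      rw [S.corr_cons_of_nonneg hy hb, S.corr_cons_of_neg hx ha, h1]
      abel
  · have hb : 0 ≤ b := ha.trans hab
    rw [S.corr_cons_of_nonneg hx ha, S.corr_cons_of_nonneg hy hb, S.corr_cons_of_nonneg hy hb,
      S.corr_cons_of_nonneg hx ha, S.corr_cons_of_nonneg hxy (by omega), ← mul_assoc, ← mul_assoc,
      ← sub_mul]
    congr 1
    rcases eq_or_ne b 0 with rfl | hb0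
    · obtain rfl : a = 0 := le_antisymm hab ha
      rw [S.rep_br hx hy]
    · rw [S.rep_of_ne hy hb0, S.rep_of_ne hxy (by omega)]
      simp

theorem corr_comm_cons (x y : L) (l : List L) :
    S.corr (x :: y :: l) - S.corr (y :: x :: l) = S.corr (S.br x y :: l) := by
  have hw := S.isWordLinear_corr
  have h0 : ∀ (l₁ l₂ : List L), S.corr (l₁ ++ (0 : L) :: l₂) = 0 := fun l₁ l₂ => by
    simpa using hw.smul l₁ l₂ 0 0
  induction x using S.gr_induction with
  | h a x hx =>
    induction y using S.gr_induction with
    | h b y hy =>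
      rcases le_total a b with hab | hab
      · exact S.corr_comm_cons_aux hx hy hab l
      · have h1 := S.corr_comm_cons_aux hy hx hab l
        have h2 := S.corr_br_swap [] l y x
        simp only [List.nil_append] at h2
        rw [h2, ← h1]
        abel
    | h0 =>
      have h1 := h0 [x] l
      have h2 := h0 [] (x :: l)
      have h3 := h0 [] l
      simp only [List.nil_append, List.cons_append] at h1 h2 h3
      rw [map_zero, h1, h2, h3, sub_zero]
    | hadd y y' h h' =>
      have := hw.add [x] l y y'
      simp only [List.nil_append, List.cons_append] at this
      rw [map_add, hw.head_add, hw.head_add, this, ← h, ← h']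
      abel
  | h0 =>
    have h1 := h0 [y] l
    have h2 := h0 [] (y :: l)
    have h3 := h0 [] l
    simp only [List.nil_append, List.cons_append] at h1 h2 h3
    rw [map_zero, LinearMap.zero_apply, h1, h2, h3, sub_zero]
  | hadd x x' h h' =>
    have := hw.add [y] l x x'
    simp only [List.nil_append, List.cons_append] at this
    rw [map_add, LinearMap.add_apply, hw.head_add, hw.head_add, this, ← h, ← h']
    abel

/-- Neighbouring letters commute up to their bracket. -/
theorem corr_comm (l₁ : List L) : ∀ (x y : L) (l₂ : List L),
    S.corr (l₁ ++ x :: y :: l₂) - S.corr (l₁ ++ y :: x :: l₂) = S.corr (l₁ ++ S.br x y :: l₂) := by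
  induction h : l₁.length generalizing l₁ with
  | zero => rw [List.length_eq_zero_iff.1 h]; exact S.corr_comm_cons
  | succ n ih =>
    obtain ⟨z, l, rfl⟩ := List.exists_cons_of_length_eq_add_one h
    replace h : l.length = n := by simpa using h
    intro x y l₂
    simp only [List.cons_append, corr_cons, derSum_append, derSum_cons]
    generalize S.neg z = z
    have e1 := ih l h x y l₂
    have e2 : derSum S.br z l (fun l' => S.corr (l' ++ x :: y :: l₂)) -
        derSum S.br z l (fun l' => S.corr (l' ++ y :: x :: l₂)) =
        derSum S.br z l (fun l' => S.corr (l' ++ S.br x y :: l₂)) := by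
      rw [← derSum_sub]
      exact derSum_congr S.br z l fun l' hl => ih l' (hl.trans h) x y l₂
    have e3 : derSum S.br z l₂ (fun l' => S.corr (l ++ x :: y :: l')) -
        derSum S.br z l₂ (fun l' => S.corr (l ++ y :: x :: l')) =
        derSum S.br z l₂ (fun l' => S.corr (l ++ S.br x y :: l')) := by
      rw [← derSum_sub]
      exact derSum_congr S.br z l₂ fun l' hl => ih l h x y l'
    have e4 := ih l h (S.br z x) y l₂
    have e5 := ih l h x (S.br z y) l₂
    have e6 := S.isWordLinear_corr.add l l₂ (S.br (S.br z x) y) (S.br x (S.br z y))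
    rw [← S.leibniz] at e6
    rw [← e1, ← e2, ← e3, e6, ← e4, ← e5, mul_sub]
    abel

/-- Lowering letters annihilate M. If z is lowering too, its bracket with y still has negative
degree. -/
theorem corr_append_neg {b : ℤ} (hb : b < 0) (l : List L) : ∀ {y : L}, y ∈ S.gr b →
    S.corr (l ++ [y]) = 0 := by
  induction h : l.length generalizing l b with
  | zero =>
    intro y hy
    rw [List.length_eq_zero_iff.1 h, List.nil_append, S.corr_cons_of_neg hy hb, derSum_nil]
  | succ n ih =>
    obtain ⟨z, l, rfl⟩ := List.exists_cons_of_length_eq_add_one h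
    replace h : l.length = n := by simpa using h
    intro y hy
    have key : ∀ a, ∀ z ∈ S.gr a, S.corr (z :: l ++ [y]) = 0 := by
      intro a z hz
      rcases lt_or_ge a 0 with ha | ha
      · rw [List.cons_append, S.corr_cons_of_neg hz ha, derSum_append, derSum_cons, derSum_nil,
          add_zero, derSum_eq_zero S.br z l fun l' hl => ih hb l' (hl.trans h) hy,
          ih (by omega) l h (S.br_mem hz hy), add_zero]
      · rw [List.cons_append, S.corr_cons_of_nonneg hz ha, ih hb l h hy, mul_zero]
    have h2 := S.hom_ext (f := S.isWordLinear_corr.slot [] (l ++ [y])) (g := 0) key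
    exact LinearMap.congr_fun h2 z

theorem corr_append_zero (l : List L) : ∀ {y : L}, y ∈ S.gr 0 →
    S.corr (l ++ [y]) = S.corr l * S.rep y := by
  induction h : l.length generalizing l with
  | zero =>
    intro y hy
    rw [List.length_eq_zero_iff.1 h, List.nil_append, S.corr_cons_of_nonneg hy le_rfl, corr_nil,
      mul_one, one_mul]
  | succ n ih =>
    obtain ⟨z, l, rfl⟩ := List.exists_cons_of_length_eq_add_one h
    replace h : l.length = n := by simpa using h
    intro y hy
    have key : ∀ a, ∀ z ∈ S.gr a, S.corr (z :: l ++ [y]) = S.corr (z :: l) * S.rep y := by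
      intro a z hz
      rcases lt_or_ge a 0 with ha | ha
      · rw [List.cons_append, S.corr_cons_of_neg hz ha, S.corr_cons_of_neg hz ha, derSum_append,
          derSum_cons, derSum_nil,
          add_zero, derSum_congr S.br z l fun l' hl => ih l' (hl.trans h) hy,
          S.corr_append_neg (by omega) l (S.br_mem hz hy), add_zero]
        exact map_derSum S.br (LinearMap.mulRight ℂ (S.rep y)) z l S.corr
      · rw [List.cons_append, S.corr_cons_of_nonneg hz ha, S.corr_cons_of_nonneg hz ha, ih l h hy,
          mul_assoc]
    have h2 := S.hom_ext (f := S.isWordLinear_corr.slot [] (l ++ [y]))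
      (g := LinearMap.mulRight ℂ (S.rep y) ∘ₗ S.isWordLinear_corr.slot [] l) key
    exact LinearMap.congr_fun h2 z

/-- Words in homogeneous letters, with their total degrees. -/
inductive IsWord : ℤ → List L → Prop
  | nil : IsWord 0 []
  | cons {a d : ℤ} {x : L} {l : List L} : x ∈ S.gr a → IsWord d l → IsWord (a + d) (x :: l)

theorem derSum_eq_zero_of_isWord {X : Type*} [AddCommGroup X] [Module ℂ X] {a : ℤ} {z : L}
    (hz : z ∈ S.gr a) {l : List L} {d : ℤ} (hl : S.IsWord d l) : ∀ {g : List L → X},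
    (∀ l', l'.length = l.length → S.IsWord (a + d) l' → g l' = 0) → derSum S.br z l g = 0 := by
  induction hl with
  | nil => intro g _; rfl
  | @cons b d y l hy hl ih =>
    intro g h
    rw [derSum_cons, h (S.br z y :: l) rfl (by rw [← add_assoc]; exact .cons (S.br_mem hz hy) hl),
      ih fun l' hl' hw => h _ (by simp [hl']) ?_, add_zero]
    rw [add_left_comm]
    exact .cons hy hw

/-- A letter can be moved to the end of a word. -/
theorem corr_move (l₁ : List L) (y : L) (l : List L) : S.corr (l₁ ++ y :: l) =
    S.corr (l₁ ++ l ++ [y]) + derSum S.br y l fun l' => S.corr (l₁ ++ l') := by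
  induction l generalizing l₁ with
  | nil => simp [derSum_nil]
  | cons x l ih =>
    have h1 := S.corr_comm l₁ y x l
    have h2 := ih (l₁ ++ [x])
    simp only [List.append_assoc, List.cons_append, List.nil_append] at h2
    rw [derSum_cons, ← h1, h2]
    simp only [List.append_assoc, List.cons_append]
    abel

/-- This makes the induced module vanish in negative degrees, which accounts for the truncation
relations. -/
theorem corr_append_of_isWord (l : List L) : ∀ {d : ℤ}, S.IsWord d l → d < 0 →
    ∀ l₁, S.corr (l₁ ++ l) = 0 := by
  induction h : l.length generalizing l with
  | zero =>
    intro d hl hd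
    rw [List.length_eq_zero_iff.1 h] at hl
    cases hl
    exact absurd hd (lt_irrefl _)
  | succ n ih =>
    intro d hl hd l₁
    cases hl with
    | nil => simp at h
    | @cons a d y l hy hl =>
      replace h : l.length = n := by simpa using h
      rcases lt_or_ge a 0 with ha | ha
      -- A lowering first letter is moved to the end, where it dies; the commutator terms are
      -- shorter words of the same degree.
      · rw [corr_move, S.corr_append_neg ha _ hy, zero_add]
        exact S.derSum_eq_zero_of_isWord hy hl fun l' hl' hw => ih l' (hl'.trans h) hw hd l₁
      -- A raising or degree zero first letter joins the prefix; the remaining word keeps negative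
      -- degree.
      · simpa using ih l h hl (by omega) (l₁ ++ [y])

end TriangularLeibniz

/-! ### The induced module modulo its radical -/

namespace TriangularLeibniz

variable {L M : Type*} [AddCommGroup L] [Module ℂ L] [AddCommGroup M] [Module ℂ M]
  (S : TriangularLeibniz L M)

/-- The function on words given by acting on `w` by the word `Y` first. -/
def wordFun (Y : List L) : M →ₗ[ℂ] (List L → M) :=
  LinearMap.pi fun l => S.corr (l ++ Y)

theorem wordFun_apply (Y : List L) (w : M) (l : List L) :
    S.wordFun Y w l = S.corr (l ++ Y) w := rfl

/-- The space of functions on words generated by `M`. -/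
def functionSpace : Submodule ℂ (List L → M) :=
  Submodule.span ℂ {f | ∃ (Y : List L) (w : M), f = S.wordFun Y w}

/-- The module of `L` induced from `M`, modulo its radical. -/
def Induced : Type _ := S.functionSpace

instance : AddCommGroup S.Induced := inferInstanceAs (AddCommGroup S.functionSpace)

instance : Module ℂ S.Induced := inferInstanceAs (Module ℂ S.functionSpace)

theorem isWordLinear_of_mem {f : List L → M} (hf : f ∈ S.functionSpace) : IsWordLinear f := by
  induction hf using Submodule.span_induction with
  | mem f hf =>
    obtain ⟨Y, w, rfl⟩ := hf
    have := S.isWordLinear_corr.append_right Y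
    constructor
    · intro l₁ l₂ x y
      exact LinearMap.congr_fun (this.add l₁ l₂ x y) w
    · intro l₁ l₂ c x
      exact LinearMap.congr_fun (this.smul l₁ l₂ c x) w
  | zero => exact ⟨by simp, by simp⟩
  | add f g _ _ hf hg =>
    constructor
    · intro l₁ l₂ x y
      simp only [Pi.add_apply, hf.add, hg.add]
      abel
    · intro l₁ l₂ c x
      simp only [Pi.add_apply, hf.smul, hg.smul, smul_add]
  | smul c f _ hf =>
    constructor
    · intro l₁ l₂ x y
      simp only [Pi.smul_apply, hf.add, smul_add]
    · intro l₁ l₂ c' x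
      simp only [Pi.smul_apply, hf.smul, smul_comm c c']

/-- Substitution of `x` for the last letter. -/
def shift (x : L) : (List L → M) →ₗ[ℂ] (List L → M) where
  toFun f l := f (l ++ [x])
  map_add' _ _ := rfl
  map_smul' _ _ := rfl

theorem shift_wordFun (x : L) (Y : List L) (w : M) :
    shift x (S.wordFun Y w) = S.wordFun (x :: Y) w := by
  ext l
  simp [shift, wordFun_apply]

theorem shift_mem (x : L) {f : List L → M} (hf : f ∈ S.functionSpace) :
    shift x f ∈ S.functionSpace := by
  induction hf using Submodule.span_induction with
  | mem f hf =>
    obtain ⟨Y, w, rfl⟩ := hf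
    exact Submodule.subset_span ⟨x :: Y, w, S.shift_wordFun x Y w⟩
  | zero => simp
  | add f g _ _ hf hg => rw [map_add]; exact add_mem hf hg
  | smul c f _ hf => rw [map_smul]; exact Submodule.smul_mem _ c hf

/-- The action of `L`. -/
def act : L →ₗ[ℂ] Module.End ℂ S.Induced :=
  LinearMap.mk₂ ℂ (fun x f => ⟨shift x f.1, S.shift_mem x f.2⟩)
    (fun x y f => Subtype.ext <| funext fun l => (S.isWordLinear_of_mem f.2).add l [] x y)
    (fun c x f => Subtype.ext <| funext fun l => (S.isWordLinear_of_mem f.2).smul l [] c x)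
    (fun _ _ _ => rfl) (fun _ _ _ => rfl)

/-- The vector obtained by acting on `w` by the word `Y`. -/
def word (Y : List L) : M →ₗ[ℂ] S.Induced :=
  (S.wordFun Y).codRestrict _ fun w => Submodule.subset_span ⟨Y, w, rfl⟩

theorem word_apply (Y l : List L) (w : M) : (S.word Y w).1 l = S.corr (l ++ Y) w := rfl

theorem act_word (x : L) (Y : List L) (w : M) : S.act x (S.word Y w) = S.word (x :: Y) w :=
  Subtype.ext (S.shift_wordFun x Y w)

/-- The evaluation at the empty word: the projection to `M`. -/
def proj : S.Induced →ₗ[ℂ] M where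
  toFun f := f.1 []
  map_add' _ _ := rfl
  map_smul' _ _ := rfl

theorem proj_apply (f : S.Induced) : S.proj f = f.1 [] := rfl

theorem proj_word_nil (w : M) : S.proj (S.word [] w) = w := rfl

theorem span_word : Submodule.span ℂ {f | ∃ (Y : List L) (w : M), f = S.word Y w} = ⊤ := by
  have := Submodule.span_span_coe_preimage (R := ℂ)
    (s := {f : List L → M | ∃ (Y : List L) (w : M), f = S.wordFun Y w})
  refine Eq.trans ?_ this
  congr 1
  ext f
  constructor
  · rintro ⟨Y, w, rfl⟩
    exact ⟨Y, w, rfl⟩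
  · rintro ⟨Y, w, h⟩
    exact ⟨Y, w, Subtype.ext h⟩

theorem word_induction {p : S.Induced → Prop} (hw : ∀ Y w, p (S.word Y w)) (h0 : p 0)
    (hadd : ∀ f g, p f → p g → p (f + g)) (hsmul : ∀ (c : ℂ) f, p f → p (c • f))
    (f : S.Induced) : p f := by
  have hf : f ∈ Submodule.span ℂ {f | ∃ (Y : List L) (w : M), f = S.word Y w} := by
    rw [span_word]; trivial
  induction hf using Submodule.span_induction with
  | mem f hf => obtain ⟨Y, w, rfl⟩ := hf; exact hw Y w
  | zero => exact h0
  | add f g _ _ hf hg => exact hadd f g hf hg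
  | smul c f _ hf => exact hsmul c f hf

theorem act_mul_sub (x y : L) : S.act x * S.act y - S.act y * S.act x = S.act (S.br x y) := by
  refine LinearMap.ext fun f => ?_
  induction f using S.word_induction with
  | hw Y w =>
    apply Subtype.ext
    funext l
    simp only [LinearMap.sub_apply, Module.End.mul_apply, act_word]
    exact LinearMap.congr_fun (S.corr_comm l x y Y) w
  | h0 => simp
  | hadd f g hf hg => rw [map_add, map_add, hf, hg]
  | hsmul c f hf => rw [map_smul, map_smul, hf]

theorem act_act (x y : L) (f : S.Induced) :
    S.act x (S.act y f) = S.act y (S.act x f) + S.act (S.br x y) f := by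
  rw [← S.act_mul_sub]; simp

theorem act_word_nil_zero {x : L} (hx : x ∈ S.gr 0) (w : M) :
    S.act x (S.word [] w) = S.word [] (S.rep x w) := by
  rw [act_word]
  refine Subtype.ext (funext fun l => ?_)
  rw [word_apply, word_apply, S.corr_append_zero l hx, List.append_nil, Module.End.mul_apply]

/-- On the component `M`, a letter of nonnegative degree acts through `rep`. -/
theorem proj_act_of_nonneg {a : ℤ} {x : L} (hx : x ∈ S.gr a) (ha : 0 ≤ a) (f : S.Induced) :
    S.proj (S.act x f) = S.rep x (S.proj f) := by
  induction f using S.word_induction with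
  | hw Y w =>
    rw [act_word, proj_apply, proj_apply, word_apply, word_apply, List.nil_append, List.nil_append,
      S.corr_cons_of_nonneg hx ha, Module.End.mul_apply]
  | h0 => simp
  | hadd f g hf hg => simp only [map_add, hf, hg]
  | hsmul c f hf => simp only [map_smul, hf]

/-- The homogeneous components. -/
def homog (d : ℤ) : Submodule ℂ S.Induced :=
  Submodule.span ℂ {f | ∃ (Y : List L) (w : M), S.IsWord d Y ∧ f = S.word Y w}

theorem word_nil_mem_homog (w : M) : S.word [] w ∈ S.homog 0 :=
  Submodule.subset_span ⟨[], w, .nil, rfl⟩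

theorem act_mem_homog {a d : ℤ} {x : L} (hx : x ∈ S.gr a) {f : S.Induced} (hf : f ∈ S.homog d) :
    S.act x f ∈ S.homog (a + d) := by
  induction hf using Submodule.span_induction with
  | mem f hf =>
    obtain ⟨Y, w, hY, rfl⟩ := hf
    rw [act_word]
    exact Submodule.subset_span ⟨x :: Y, w, .cons hx hY, rfl⟩
  | zero => simp
  | add f g _ _ hf hg => rw [map_add]; exact add_mem hf hg
  | smul c f _ hf => rw [map_smul]; exact Submodule.smul_mem _ c hf

theorem eq_zero_of_mem_homog {d : ℤ} (hd : d < 0) {f : S.Induced} (hf : f ∈ S.homog d) :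
    f = 0 := by
  induction hf using Submodule.span_induction with
  | mem f hf =>
    obtain ⟨Y, w, hY, rfl⟩ := hf
    refine Subtype.ext (funext fun l => ?_)
    rw [word_apply, S.corr_append_of_isWord Y hY hd l]
    rfl
  | zero => rfl
  | add f g _ _ hf hg => rw [hf, hg, add_zero]
  | smul c f _ hf => rw [hf, smul_zero]

theorem act_eq_zero {a d : ℤ} {x : L} (hx : x ∈ S.gr a) {f : S.Induced} (hf : f ∈ S.homog d)
    (h : a + d < 0) : S.act x f = 0 :=
  S.eq_zero_of_mem_homog h (S.act_mem_homog hx hf)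

theorem iSup_homog : ⨆ d, S.homog d = ⊤ := by
  have key : ∀ Y : List L, ∀ w : M, S.word Y w ∈ ⨆ d, S.homog d := by
    intro Y w
    induction Y with
    | nil => exact Submodule.mem_iSup_of_mem 0 (S.word_nil_mem_homog w)
    | cons x Y ih =>
      rw [← act_word]
      generalize S.word Y w = f at ih
      induction ih using Submodule.iSup_induction' with
      | mem d f hf =>
        induction x using S.gr_induction with
        | h a x hx => exact Submodule.mem_iSup_of_mem (a + d) (S.act_mem_homog hx hf)
        | h0 => simp
        | hadd x y hx hy => rw [map_add]; exact add_mem hx hy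
      | zero => simp
      | add f g _ _ hf hg => rw [map_add]; exact add_mem hf hg
  rw [eq_top_iff, ← span_word, Submodule.span_le]
  rintro f ⟨Y, w, rfl⟩
  exact key Y w

theorem homog_induction {p : S.Induced → Prop} (h : ∀ d, ∀ f ∈ S.homog d, p f)
    (h0 : p 0) (hadd : ∀ f g, p f → p g → p (f + g)) (f : S.Induced) : p f :=
  Submodule.iSup_induction S.homog (motive := p) (S.iSup_homog ▸ Submodule.mem_top) h h0 hadd

theorem derSum_mem {X : Type*} [AddCommGroup X] [Module ℂ X] (C : Submodule ℂ X) (z : L)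
    (l : List L) : ∀ {g : List L → X}, (∀ l', l'.length = l.length → g l' ∈ C) →
    derSum S.br z l g ∈ C := by
  induction l with
  | nil => intro g _; exact C.zero_mem
  | cons y l ih =>
    intro g h
    exact C.add_mem (h _ (by simp)) (ih fun l' hl' => h _ (by simp [hl']))

/-- A subspace that contains `M` and is stable under letters of nonnegative degree is everything. -/
theorem eq_top_of_raising (C : Submodule ℂ S.Induced) (h0 : ∀ w, S.word [] w ∈ C)
    (h : ∀ a, 0 ≤ a → ∀ x ∈ S.gr a, ∀ f ∈ C, S.act x f ∈ C) : C = ⊤ := by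
  have key : ∀ (n : ℕ) (Y : List L), Y.length = n → ∀ w, S.word Y w ∈ C := by
    intro n
    induction n with
    | zero => intro Y hY w; rw [List.length_eq_zero_iff.1 hY]; exact h0 w
    | succ n ih =>
      intro Y hY w
      obtain ⟨y, l, rfl⟩ := List.exists_cons_of_length_eq_add_one hY
      replace hY : l.length = n := by simpa using hY
      rw [← act_word]
      induction y using S.gr_induction with
      | h a y hy =>
        rcases lt_or_ge a 0 with ha | ha
        -- A lowering letter contributes only its brackets with the letters of l, so no longer word
        -- is needed.
        · have : S.act y (S.word l w) = derSum S.br y l fun l' => S.word l' w := by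
            have e := map_derSum S.br S.functionSpace.subtype y l fun l' => S.word l' w
            refine Subtype.ext (funext fun l₁ => ?_)
            change _ = S.functionSpace.subtype (derSum S.br y l fun l' => S.word l' w) l₁
            rw [← e]
            have e2 := map_derSum S.br (LinearMap.proj l₁ : (List L → M) →ₗ[ℂ] M) y l
              fun l' => S.functionSpace.subtype (S.word l' w)
            rw [LinearMap.proj_apply] at e2
            rw [← e2, act_word, word_apply, corr_move, S.corr_append_neg ha _ hy, zero_add]
            exact (map_derSum S.br (LinearMap.applyₗ w : Module.End ℂ M →ₗ[ℂ] M) y l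
              fun l' => S.corr (l₁ ++ l')).symm
          rw [this]
          exact S.derSum_mem C y l fun l' hl' => ih l' (hl'.trans hY) w
        · exact h a ha y hy _ (ih l hY w)
      | h0 => simp
      | hadd x y hx hy =>
        rw [map_add]
        exact C.add_mem hx hy
  rw [eq_top_iff, ← span_word, Submodule.span_le]
  rintro f ⟨Y, w, rfl⟩
  exact key _ Y rfl w

/-- A space of operators that is stable under commutators with the action of `L` and vanishes
between `M` and `M` is zero. -/
theorem eq_zero_of_ad_stable (J : Submodule ℂ (Module.End ℂ S.Induced))
    (had : ∀ a, ∀ x ∈ S.gr a, ∀ j ∈ J, S.act x * j - j * S.act x ∈ J)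
    (htop : ∀ j ∈ J, ∀ w, S.proj (j (S.word [] w)) = 0) {j : Module.End ℂ S.Induced}
    (hj : j ∈ J) : j = 0 := by
  have hproj : ∀ f, ∀ j ∈ J, S.proj (j f) = 0 := by
    let C : Submodule ℂ S.Induced :=
      { carrier := {f | ∀ j ∈ J, S.proj (j f) = 0}
        zero_mem' := fun j _ => by simp
        add_mem' := fun {f g} hf hg j hj => by rw [map_add, map_add, hf j hj, hg j hj, add_zero]
        smul_mem' := fun c f hf j hj => by rw [map_smul, map_smul, hf j hj, smul_zero] }
    have hC : C = ⊤ := by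
      refine S.eq_top_of_raising C (fun w j hj => htop j hj w) fun a ha x hx f hf j hj => ?_
      -- Projecting x(jf) to M gives `rep x` of the projection of jf, which is zero; so the
      -- commutator controls j(xf).
      have h1 := hf _ (had a x hx j hj)
      rw [LinearMap.sub_apply, map_sub, Module.End.mul_apply, Module.End.mul_apply,
        S.proj_act_of_nonneg hx ha, hf j hj, map_zero, zero_sub, neg_eq_zero] at h1
      exact h1
    intro f
    have : f ∈ C := hC ▸ Submodule.mem_top
    exact this
  have had' : ∀ x, ∀ j ∈ J, S.act x * j - j * S.act x ∈ J := by
    intro x j hj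
    induction x using S.gr_induction with
    | h a x hx => exact had a x hx j hj
    | h0 =>
      have : S.act 0 * j - j * S.act 0 = 0 := LinearMap.ext fun f => by simp
      rw [this]
      exact J.zero_mem
    | hadd x y hx hy =>
      have : S.act (x + y) * j - j * S.act (x + y) =
          (S.act x * j - j * S.act x) + (S.act y * j - j * S.act y) := by
        rw [map_add, add_mul, mul_add]; abel
      rw [this]
      exact add_mem hx hy
  have hword : ∀ l : List L, ∀ j ∈ J, ∀ f, (j f).1 l = 0 := by
    -- The value at l ++ [x] of jf is the value at l of x(jf), and x can be commuted past j within
    -- J.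
    intro l
    induction l using List.reverseRecOn with
    | nil => exact fun j hj f => hproj f j hj
    | append_singleton l x ih =>
      intro j hj f
      have h1 := ih _ (had' x j hj) f
      rw [LinearMap.sub_apply, Module.End.mul_apply, Module.End.mul_apply] at h1
      have h2 : (S.act x (j f)).1 l - (j (S.act x f)).1 l = 0 := h1
      rwa [ih j hj, sub_zero] at h2
  exact LinearMap.ext fun f => Subtype.ext (funext fun l => hword l j hj f)

end TriangularLeibniz

/-! ### Binomial identities for locally finite sums -/

section Sums

open Finset

variable {X : Type*} [AddCommGroup X]

theorem sum_range_eq_of_le {c : ℕ → X} {N N' : ℕ} (h : ∀ j, N ≤ j → c j = 0) (hN : N ≤ N') :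
    ∑ j ∈ range N', c j = ∑ j ∈ range N, c j :=
  eventually_constant_sum h hN

theorem sum_range_sum_range_eq_sum_antidiagonal {f : ℕ → ℕ → X} {N : ℕ}
    (h : ∀ i j, N ≤ i + j → f i j = 0) :
    ∑ i ∈ range N, ∑ j ∈ range N, f i j =
      ∑ k ∈ range N, ∑ p ∈ antidiagonal k, f p.1 p.2 := by
  simp only [Nat.sum_antidiagonal_eq_sum_range_succ f]
  rw [Finset.sum_range_diag_flip]
  refine sum_congr rfl fun i _ => sum_range_eq_of_le (fun j hj => h i j ?_) (Nat.sub_le _ _)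
  omega

/-- The Chu–Vandermonde identity, applied to a locally finite sum. -/
theorem sum_choose_smul_choose_smul {c : ℕ → X} {N : ℕ} (h : ∀ j, N ≤ j → c j = 0) (m r : ℤ) :
    ∑ i ∈ range N, ∑ k ∈ range N, Ring.choose m i • Ring.choose r k • c (i + k) =
      ∑ j ∈ range N, Ring.choose (m + r) j • c j := by
  rw [sum_range_sum_range_eq_sum_antidiagonal fun i j hij => by rw [h _ hij, smul_zero, smul_zero]]
  refine sum_congr rfl fun k _ => ?_
  rw [Ring.add_choose_eq k (Commute.all m r), sum_smul]
  refine sum_congr rfl fun p hp => ?_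
  rw [mem_antidiagonal.1 hp, mul_smul]

/-- Rests on (r choose k)(k choose s) = (r choose s)(r - s choose k - s), followed by the shift k ↦
k + s. -/
theorem sum_choose_smul_choose_natCast_smul {c : ℕ → X} {N s : ℕ}
    (h : ∀ j, N ≤ j + s → c j = 0) (r : ℤ) :
    ∑ k ∈ range N, Ring.choose r k • Ring.choose (k : ℤ) s • c (k - s) =
      Ring.choose r s • ∑ k ∈ range N, Ring.choose (r - s) k • c k := by
  rcases le_or_gt N s with hs | hs
  · rw [sum_eq_zero, sum_eq_zero, smul_zero]
    · intro k _
      rw [h k (by omega), smul_zero]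
    · intro k hk
      rw [h _ (by omega), smul_zero, smul_zero]
  obtain ⟨t, rfl⟩ := Nat.exists_eq_add_of_lt hs
  rw [show s + t + 1 = s + (t + 1) by ring, sum_range_add, sum_eq_zero, zero_add,
    sum_range_eq_of_le (N := t + 1) (N' := s + (t + 1)) (fun j hj => ?_) (by omega), smul_sum]
  · refine sum_congr rfl fun k _ => ?_
    rw [← mul_smul, ← mul_smul, Ring.choose_natCast, mul_comm]
    have := Ring.choose_smul_choose r (Nat.le_add_right s k)
    rw [nsmul_eq_mul, Nat.add_sub_cancel_left] at this
    rw [this, Nat.add_sub_cancel_left]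
  · rw [h j (by omega), smul_zero]
  · intro k hk
    rw [Ring.choose_natCast, Nat.choose_eq_zero_of_lt (mem_range.1 hk)]
    simp

theorem negOnePow_natCast (n : ℕ) : (((n : ℤ).negOnePow : ℤˣ) : ℤ) = (-1) ^ n := by
  simp [Int.negOnePow_def]

theorem choose_neg_one (i : ℕ) : Ring.choose (-1 : ℤ) i = (-1) ^ i := by
  rw [Ring.choose_neg, show (1 : ℤ) + i - 1 = (i : ℤ) by ring, Ring.choose_natCast, Nat.choose_self,
    Int.negOnePow_def, Units.smul_def]
  simp

theorem choose_eq_zero_of_lt {n : ℤ} (hn : 0 ≤ n) {j : ℕ} (h : n < j) : Ring.choose n j = 0 := by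
  lift n to ℕ using hn
  rw [Ring.choose_natCast, Nat.choose_eq_zero_of_lt (by exact_mod_cast h)]
  rfl

end Sums

/-! ### Commutators and skew-symmetry, modulo `O(V)` -/

namespace NGradedVertexAlgebra

open Finset

variable {V : Type*} [AddCommGroup V] [Module ℂ V] (A : NGradedVertexAlgebra V)

theorem gr_induction {p : V → Prop} (h : ∀ a, ∀ x ∈ A.gr a, p x)
    (h0 : p 0) (hadd : ∀ x y, p x → p y → p (x + y)) (x : V) : p x :=
  Submodule.iSup_induction A.gr (motive := p)
    (A.isInternal.submodule_iSup_eq_top ▸ Submodule.mem_top) h h0 hadd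

theorem eq_zero_of_mem_gr {n : ℤ} (hn : n < 0) {u : V} (hu : u ∈ A.gr n) : u = 0 := by
  rwa [A.gr_neg n hn, Submodule.mem_bot] at hu

theorem mode_mem {a b : ℤ} {u v : V} (hu : u ∈ A.gr a) (hv : v ∈ A.gr b) (k : ℤ) :
    A.mode k u v ∈ A.gr (a + b - k - 1) := A.ncoeff_mem a b k u v hu hv

theorem mode_eq_zero {a b : ℤ} {u v : V} (hu : u ∈ A.gr a) (hv : v ∈ A.gr b) {k : ℤ}
    (h : a + b ≤ k) : A.mode k u v = 0 :=
  A.eq_zero_of_mem_gr (by omega) (A.mode_mem hu hv k)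

/-- The commutator formula. -/
theorem mode_mode {a b : ℤ} {u v : V} (hu : u ∈ A.gr a) (hv : v ∈ A.gr b) (m n : ℤ) (w : V)
    {N : ℕ} (hN : a + b ≤ N) :
    A.mode m u (A.mode n v w) = A.mode n v (A.mode m u w) +
      ∑ i ∈ range N, Ring.choose m i • A.mode (m + n - i) (A.mode i u v) w := by
  have h := A.jacobi u v w 0 m n
  rw [finsum_eq_sum_of_support_subset (s := range N), finsum_eq_single _ 0,
    finsum_eq_single _ 0] at h
  · simp only [zero_add, Ring.choose_zero_right, pow_zero, Nat.cast_zero, one_mul, one_smul,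
      add_zero, sub_zero, Int.negOnePow_zero, Units.val_one] at h
    have h' := eq_add_of_sub_eq' h.symm
    exact h'
  · intro i hi
    rw [Ring.choose_zero_pos _ (Nat.pos_of_ne_zero hi), mul_zero, zero_smul]
  · intro i hi
    rw [Ring.choose_zero_pos _ (Nat.pos_of_ne_zero hi), mul_zero, zero_smul]
  · intro i hi
    by_contra hi'
    have hi'' : N ≤ i := by simpa using hi'
    refine hi ?_
    have h0 : VertexOperator.ncoeff (A.Y u) (0 + i) v = 0 :=
      A.mode_eq_zero hu hv (by omega)
    simp only [h0, map_zero]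
    simp

/-- Skew-symmetry. -/
theorem mode_swap {a b : ℤ} {u v : V} (hu : u ∈ A.gr a) (hv : v ∈ A.gr b) (l : ℤ)
    {N : ℕ} (hN : a + b ≤ l + N) :
    A.mode l v u = -((l.negOnePow : ℤ) • ∑ i ∈ range N,
      (-1 : ℤ) ^ i • A.mode (-1 - i) (A.mode (l + i) u v) A.vac) := by
  -- On the vacuum, creation kills all terms with v acting first, and leaves only v_l u_{-1}𝟏 = v_l
  -- u among the others.
  have h := A.jacobi u v A.vac l (-1) 0
  rw [finsum_eq_sum_of_support_subset (s := range N), finsum_eq_single _ 0,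
    finsum_eq_single _ 0] at h
  · rw [show (0 : ℤ) + ((0 : ℕ) : ℤ) = 0 by simp, A.ncoeff_vac v 0 le_rfl, map_zero, smul_zero,
      zero_sub, show (-1 : ℤ) + ((0 : ℕ) : ℤ) = -1 by simp, A.ncoeff_neg_one_vac] at h
    simp only [Ring.choose_zero_right, pow_zero, Nat.cast_zero, one_mul, one_smul,
      sub_zero, choose_neg_one, add_zero, zero_add] at h
    have h2 : ∑ i ∈ range N, (-1 : ℤ) ^ i • A.mode (-1 - i) (A.mode (l + i) u v) A.vac =
      -((l.negOnePow : ℤ) • A.mode l v u) := h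
    rw [h2, smul_neg, neg_neg, ← mul_smul]
    rcases Int.units_eq_one_or l.negOnePow with h | h <;> simp [h]
  · intro i hi
    rw [A.ncoeff_vac u _ (by omega), map_zero, smul_zero]
  · intro i hi
    rw [A.ncoeff_vac v _ (by omega), map_zero, smul_zero]
  · intro i hi
    by_contra hi'
    have hi'' : N ≤ i := by simpa using hi'
    refine hi ?_
    have h0 : VertexOperator.ncoeff (A.Y u) (l + i) v = 0 :=
      A.mode_eq_zero hu hv (by omega)
    simp only [h0, map_zero]
    simp

theorem zhuRes_of_mem {a : ℤ} {u : V} (hu : u ∈ A.gr a) (n : ℤ) (v : V) {N : ℕ} (hN : a < N) :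
    A.zhuRes n u v = ∑ j ∈ range N, Ring.choose a j • A.mode (n + j) u v := by
  rw [zhuRes, A.extend_of_mem _ hu]
  simp only [LinearMap.sum_apply, LinearMap.smul_apply]
  rcases lt_or_ge a 0 with ha | ha
  · rw [A.eq_zero_of_mem_gr ha hu]
    simp
  · refine (sum_range_eq_of_le (fun j hj => ?_) (by omega)).symm
    rw [choose_eq_zero_of_lt ha (by omega), zero_smul]

variable {X : Type*} [AddCommGroup X] [Module ℂ X] {ψ : V →ₗ[ℂ] X}

/-- Modulo `O(V)`, the derivative acts as minus the weight. -/
theorem map_mode_vac (hψ : ∀ u ∈ A.zhuO, ψ u = 0) {a : ℤ} {u : V} (hu : u ∈ A.gr a) (i : ℕ) :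
    ψ (A.mode (-1 - i) u A.vac) = Ring.choose (-a) i • ψ u := by
  have hz : ∀ k : ℤ, 0 ≤ k → A.mode k u A.vac = 0 := fun k hk => A.ncoeff_vac u k hk
  induction i using Nat.strong_induction_on with
  | _ i ih =>
  rcases Nat.eq_zero_or_pos i with rfl | hi
  · have : A.mode (-1) u A.vac = u := A.ncoeff_neg_one_vac u
    simp [this]
  -- By creation, this element of O(V) ends at j = i. It gives a recursion for the images of
  -- u_{-1-i}𝟏, solved by Vandermonde for a + (-a) = 0.
  have hO : A.zhuRes (-1 - i) u A.vac ∈ A.zhuO :=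
    Submodule.subset_span ⟨u, A.vac, -1 - i, by omega, rfl⟩
  set N := (max a i).toNat + 1 with hNdef
  have h1 := hψ _ hO
  rw [A.zhuRes_of_mem hu (-1 - i) A.vac (N := N) (by omega), map_sum,
    sum_range_eq_of_le (N := i + 1) (fun j hj => by
      rw [hz _ (by omega), smul_zero, map_zero]) (by omega)] at h1
  have h2 := Ring.add_choose_eq i (Commute.all a (-a))
  rw [add_neg_cancel, Ring.choose_zero_pos _ hi,
    Nat.sum_antidiagonal_eq_sum_range_succ (fun p q => Ring.choose a p * Ring.choose (-a) q)] at h2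
  rw [Nat.succ_eq_add_one, sum_range_succ'] at h2
  rw [sum_range_succ'] at h1
  have h3 : ∑ k ∈ range i, ψ (Ring.choose a (k + 1) • A.mode (-1 - i + ((k + 1 : ℕ) : ℤ)) u A.vac) =
      (∑ k ∈ range i, Ring.choose a (k + 1) * Ring.choose (-a) (i - (k + 1))) • ψ u := by
    rw [sum_smul]
    refine sum_congr rfl fun k hk => ?_
    have hk' := mem_range.1 hk
    rw [map_zsmul, show (-1 : ℤ) - i + ((k + 1 : ℕ) : ℤ) = -1 - ((i - (k + 1) : ℕ) : ℤ) by omega,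
      ih _ (by omega), mul_smul]
  rw [h3] at h1
  simp only [Ring.choose_zero_right, one_smul, one_mul, Nat.cast_zero, add_zero, Nat.sub_zero] at h1 h2
  rw [eq_neg_of_add_eq_zero_left h2.symm, neg_smul] at h1
  exact (neg_add_eq_zero.1 h1).symm

/-- Skew-symmetry modulo `O(V)`. -/
theorem map_sum_mode_swap (hψ : ∀ u ∈ A.zhuO, ψ u = 0) {a b : ℤ} {u v : V} (hu : u ∈ A.gr a)
    (hv : v ∈ A.gr b) (k n : ℤ) {N : ℕ} (hN : a + b ≤ k + N) :
    ∑ l ∈ range N, Ring.choose n l • ψ (A.mode (k + l) v u) =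
      -((k.negOnePow : ℤ) • ∑ j ∈ range N,
        Ring.choose (a + b - n - k - 2) j • ψ (A.mode (k + j) u v)) := by
  have h1 : ∀ l : ℕ, Ring.choose n l • ψ (A.mode (k + l) v u) =
      -((k.negOnePow : ℤ) • ∑ i ∈ range N, (-1 : ℤ) ^ (l + i) • (Ring.choose n l *
        Ring.choose (k + 1 - a - b + ((l + i : ℕ) : ℤ)) i) •
          ψ (A.mode (k + ((l + i : ℕ) : ℤ)) u v)) := by
    intro l
    rw [A.mode_swap hu hv (k + l) (N := N) (by omega), map_neg, map_zsmul, map_sum, smul_neg,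
      Int.negOnePow_add, smul_comm, smul_sum, Units.val_mul, mul_smul, smul_sum]
    congr 2
    refine sum_congr rfl fun i _ => ?_
    rw [map_zsmul, A.map_mode_vac hψ (A.mode_mem hu hv _)]
    simp only [← mul_smul]
    rw [show k + (l : ℤ) + i = k + ((l + i : ℕ) : ℤ) by push_cast; ring,
      show -(a + b - (k + ((l + i : ℕ) : ℤ)) - 1) = k + 1 - a - b + ((l + i : ℕ) : ℤ) by ring]
    congr 1
    rw [negOnePow_natCast, pow_add]
    ring
  rw [sum_congr rfl fun l _ => h1 l, sum_neg_distrib, ← smul_sum]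
  congr 2
  rw [sum_range_sum_range_eq_sum_antidiagonal]
  · refine sum_congr rfl fun j _ => ?_
    -- Upper negation brings the coefficient into the form produced by Vandermonde on the
    -- antidiagonal l + i = j.
    have h2 : Ring.choose (a + b - n - k - 2) j =
        (-1) ^ j * Ring.choose (n + (k + 1 - a - b + j)) j := by
      rw [show a + b - n - k - 2 = -(n + k + 2 - a - b) by ring, Ring.choose_neg,
        Units.smul_def, negOnePow_natCast, smul_eq_mul]
      congr 2
      ring
    rw [h2, Ring.add_choose_eq j (Commute.all _ _), mul_sum, sum_smul]
    refine sum_congr rfl fun p hp => ?_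
    simp only [mem_antidiagonal.1 hp, mul_smul]
  · intro i j hij
    rw [A.mode_eq_zero hu hv (by omega), map_zero, smul_zero, smul_zero]

end NGradedVertexAlgebra

/-! ### The Leibniz algebra V[t, t⁻¹] and its degree zero action -/

namespace NGradedVertexAlgebra

open Finset

/-- The letter `u(m)` of the loop space `V[t, t⁻¹]`, realized as `ℤ →₀ V`. -/
def letter {V : Type*} [AddCommGroup V] [Module ℂ V] (m : ℤ) : V →ₗ[ℂ] (ℤ →₀ V) :=
  Finsupp.lsingle m

variable {V : Type*} [AddCommGroup V] [Module ℂ V] (A : NGradedVertexAlgebra V)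

theorem letter_induction {p : (ℤ →₀ V) → Prop} (h : ∀ k m, ∀ u ∈ A.gr k, p (letter m u))
    (h0 : p 0) (hadd : ∀ x y, p x → p y → p (x + y)) (x : ℤ →₀ V) : p x := by
  induction x using Finsupp.induction_linear with
  | zero => exact h0
  | add x y hx hy => exact hadd x y hx hy
  | single m u =>
    change p (letter m u)
    induction u using A.gr_induction with
    | h k u hu => exact h k m u hu
    | h0 => rwa [map_zero]
    | hadd x y hx hy => rw [map_add]; exact hadd _ _ hx hy

/-- The bracket of `u(m)` and `v(n)`, as a function of `u` and `v`. -/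
def letterBracket (m n : ℤ) : V →ₗ[ℂ] V →ₗ[ℂ] (ℤ →₀ V) :=
  A.extend fun a => (A.extend fun b => ∑ j ∈ range (a + b).toNat,
    Ring.choose m j • ((A.mode j).compr₂ (letter (m + n - j))).flip).flip

/-- The bracket of `V[t, t⁻¹]` given by the commutator formula. -/
def bracket : (ℤ →₀ V) →ₗ[ℂ] (ℤ →₀ V) →ₗ[ℂ] (ℤ →₀ V) :=
  Finsupp.lsum ℂ fun m => (Finsupp.lsum ℂ fun n => (A.letterBracket m n).flip).flip

/-- The coefficient `∑ⱼ (m choose j) (u_{a+j} v)(m + n - j)` of the iterate of two vertex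
operators, with the sum cut off at `N`. -/
def iterLetter (N : ℕ) (a m n : ℤ) (u v : V) : ℤ →₀ V :=
  ∑ j ∈ range N, Ring.choose m j • letter (m + n - j) (A.mode (a + j) u v)

theorem iterLetter_of_le {α β a : ℤ} {u v : V} (hu : u ∈ A.gr α) (hv : v ∈ A.gr β) (m n : ℤ)
    {N N' : ℕ} (hN : α + β ≤ a + N) (h : N ≤ N') :
    A.iterLetter N' a m n u v = A.iterLetter N a m n u v :=
  sum_range_eq_of_le (fun j hj => by
    rw [A.mode_eq_zero hu hv (by omega), map_zero, smul_zero]) h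

theorem bracket_letter {a b : ℤ} {u v : V} (hu : u ∈ A.gr a) (hv : v ∈ A.gr b) (m n : ℤ)
    {N : ℕ} (hN : a + b ≤ N) :
    A.bracket (letter m u) (letter n v) = A.iterLetter N 0 m n u v := by
  have h1 : A.bracket (letter m u) (letter n v) = A.letterBracket m n u v := by
    simp [bracket, letter]
  rw [h1, letterBracket, A.extend_of_mem _ hu, LinearMap.flip_apply, A.extend_of_mem _ hv]
  simp only [LinearMap.sum_apply, LinearMap.smul_apply, LinearMap.flip_apply,
    LinearMap.compr₂_apply]
  rw [A.iterLetter_of_le hu hv m n (N := (a + b).toNat) (by omega) (by omega)]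
  simp only [iterLetter, zero_add]

/-- The bracket with a letter is a derivation of all iterates. -/
theorem bracket_iterLetter {α β γ : ℤ} {u v z : V} (hu : u ∈ A.gr α) (hv : v ∈ A.gr β)
    (hz : z ∈ A.gr γ) (r a m n : ℤ) {N : ℕ} (h1 : γ + α ≤ N) (h2 : γ + α + β ≤ a + N) :
    A.bracket (letter r z) (A.iterLetter N a m n u v) =
      ∑ k ∈ range N, Ring.choose r k • (A.iterLetter N a (r + m - k) n (A.mode k z u) v +
        A.iterLetter N a m (r + n - k) u (A.mode k z v)) := by
  -- Here z_k is commuted past u_{a+i}. The terms (z_s u) are reindexed by k - s, so that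
  -- Vandermonde can later merge the sums over i and k.
  have e1 : ∀ i : ℕ, A.bracket (letter r z) (letter (m + n - i) (A.mode (a + i) u v)) =
      (∑ k ∈ range N, Ring.choose r k • letter (r + (m + n - i) - k)
        (A.mode (a + i) u (A.mode k z v))) +
      ∑ s ∈ range N, Ring.choose r s • ∑ k ∈ range N, Ring.choose (r - s) k •
        letter (r + m + n - s - ((i + k : ℕ) : ℤ))
          (A.mode (a + ((i + k : ℕ) : ℤ)) (A.mode s z u) v) := by
    intro i
    rw [A.bracket_letter hz (A.mode_mem hu hv _) (N := N) _ _ (by omega)]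
    have e2 : ∀ s : ℕ, Ring.choose r s • ∑ k ∈ range N, Ring.choose (r - s) k •
        letter (r + m + n - s - ((i + k : ℕ) : ℤ))
          (A.mode (a + ((i + k : ℕ) : ℤ)) (A.mode s z u) v) =
        ∑ k ∈ range N, Ring.choose r k • Ring.choose (k : ℤ) s •
          letter (r + (m + n - i) - k) (A.mode (k + (a + i) - s) (A.mode s z u) v) := by
      intro s
      rw [← sum_choose_smul_choose_natCast_smul (c := fun k =>
        letter (r + m + n - s - ((i + k : ℕ) : ℤ))
          (A.mode (a + ((i + k : ℕ) : ℤ)) (A.mode s z u) v)) fun j hj => ?_]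
      · refine sum_congr rfl fun k _ => ?_
        rcases lt_or_ge k s with hk | hk
        · rw [Ring.choose_natCast, Nat.choose_eq_zero_of_lt hk]
          simp
        · rw [show r + m + n - s - ((i + (k - s) : ℕ) : ℤ) = r + (m + n - i) - k by omega,
            show a + ((i + (k - s) : ℕ) : ℤ) = k + (a + i) - s by omega]
      · rw [A.mode_eq_zero (A.mode_mem hz hu _) hv (by push_cast; omega), map_zero]
    rw [sum_congr rfl fun s _ => e2 s, sum_comm, ← sum_add_distrib, iterLetter]
    refine sum_congr rfl fun k _ => ?_
    rw [zero_add, A.mode_mode hz hu _ _ v h1, map_add, map_sum, smul_add, smul_sum]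
    simp only [map_zsmul]
  rw [iterLetter, map_sum]
  simp only [map_zsmul, e1, smul_add, sum_add_distrib, smul_sum]
  rw [add_comm]
  congr 1
  · rw [sum_comm]
    refine sum_congr rfl fun s _ => ?_
    have h3 := sum_choose_smul_choose_smul (N := N) (c := fun j =>
        letter (r + m + n - s - j) (A.mode (a + j) (A.mode s z u) v)) (fun j hj => by
          rw [A.mode_eq_zero (A.mode_mem hz hu _) hv (by omega), map_zero]) m (r - s)
    rw [iterLetter, show r + m - s = m + (r - s) by ring, smul_sum]
    have h4 := congrArg (fun x => Ring.choose r s • x) h3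
    simp only [smul_sum] at h4
    refine Eq.trans ?_ (h4.trans ?_)
    · refine sum_congr rfl fun i _ => sum_congr rfl fun k _ => ?_
      rw [smul_comm (Ring.choose m i)]
    · refine sum_congr rfl fun j _ => ?_
      rw [show r + m + n - s - j = m + (r - s) + n - j by ring]
  · rw [sum_comm]
    refine sum_congr rfl fun k _ => ?_
    rw [iterLetter, smul_sum]
    refine sum_congr rfl fun i _ => ?_
    rw [smul_comm, show r + (m + n - i) - k = m + (r + n - k) - i by ring]

/-- The bracket is itself the iterate with a = 0, so this is a case of `bracket_iterLetter`. -/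
theorem bracket_leibniz (x y z : ℤ →₀ V) : A.bracket x (A.bracket y z) =
    A.bracket (A.bracket x y) z + A.bracket y (A.bracket x z) := by
  induction x using A.letter_induction with
  | h γ r x hx =>
    induction y using A.letter_induction with
    | h α m u hu =>
      induction z using A.letter_induction with
      | h β n v hv =>
        set N := α.natAbs + β.natAbs + γ.natAbs with hN
        rw [A.bracket_letter hu hv m n (N := N) (by omega),
          A.bracket_iterLetter hu hv hx r 0 m n (by omega) (by omega),
          A.bracket_letter hx hu r m (N := N) (by omega),
          A.bracket_letter hx hv r n (N := N) (by omega)]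
        rw [iterLetter, iterLetter, map_sum, map_sum, LinearMap.sum_apply, ← sum_add_distrib]
        refine sum_congr rfl fun k _ => ?_
        rw [map_zsmul, map_zsmul, LinearMap.smul_apply, ← smul_add, zero_add,
          A.bracket_letter (A.mode_mem hx hu _) hv (N := N) _ _ (by omega),
          A.bracket_letter hu (A.mode_mem hx hv _) (N := N) _ _ (by omega)]
      | h0 => simp
      | hadd z z' h h' => simp only [map_add, h, h']; abel
    | h0 => simp
    | hadd y y' h h' => simp only [map_add, LinearMap.add_apply, h, h']; abel
  | h0 => simp
  | hadd x x' h h' => simp only [map_add, LinearMap.add_apply, h, h']; abel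

/-- The grading of `V[t, t⁻¹]`. -/
def loopGr (d : ℤ) : Submodule ℂ (ℤ →₀ V) :=
  Submodule.span ℂ {x | ∃ (k m : ℤ) (u : V), u ∈ A.gr k ∧ k - m - 1 = d ∧ x = letter m u}

theorem letter_mem {k m d : ℤ} {u : V} (hu : u ∈ A.gr k) (h : k - m - 1 = d) :
    letter m u ∈ A.loopGr d :=
  Submodule.subset_span ⟨k, m, u, hu, h, rfl⟩

theorem loopGr_induction {d : ℤ} {p : (x : ℤ →₀ V) → x ∈ A.loopGr d → Prop}
    (h : ∀ k m u (hu : u ∈ A.gr k) (hk : k - m - 1 = d), p (letter m u) (A.letter_mem hu hk))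
    (h0 : p 0 (zero_mem _))
    (hadd : ∀ x y hx hy, p x hx → p y hy → p (x + y) (add_mem hx hy))
    (hsmul : ∀ (c : ℂ) x hx, p x hx → p (c • x) (Submodule.smul_mem _ c hx))
    {x : ℤ →₀ V} (hx : x ∈ A.loopGr d) : p x hx := by
  induction hx using Submodule.span_induction with
  | mem x hx => obtain ⟨k, m, u, hu, hk, rfl⟩ := hx; exact h k m u hu hk
  | zero => exact h0
  | add x y hx' hy' hx hy => exact hadd x y hx' hy' hx hy
  | smul c x hx' hx => exact hsmul c x hx' hx

theorem iSup_loopGr : ⨆ d, A.loopGr d = ⊤ := by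
  rw [eq_top_iff]
  rintro x -
  induction x using A.letter_induction with
  | h k m u hu => exact Submodule.mem_iSup_of_mem _ (A.letter_mem hu rfl)
  | h0 => exact zero_mem _
  | hadd x y hx hy => exact add_mem hx hy

theorem iterLetter_mem {α β : ℤ} {u v : V} (hu : u ∈ A.gr α) (hv : v ∈ A.gr β) (N : ℕ)
    (a m n : ℤ) : A.iterLetter N a m n u v ∈ A.loopGr (α + β - a - m - n - 2) :=
  Submodule.sum_mem _ fun j _ => zsmul_mem (A.letter_mem (A.mode_mem hu hv _) (by ring)) _

theorem bracket_mem {a b : ℤ} {x y : ℤ →₀ V} (hx : x ∈ A.loopGr a) (hy : y ∈ A.loopGr b) :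
    A.bracket x y ∈ A.loopGr (a + b) := by
  induction hx using A.loopGr_induction with
  | h k m u hu hk =>
    induction hy using A.loopGr_induction with
    | h l n v hv hl =>
      rw [A.bracket_letter hu hv m n (N := (k + l).toNat) (by omega)]
      have := A.iterLetter_mem hu hv (k + l).toNat 0 m n
      rwa [show k + l - 0 - m - n - 2 = a + b by omega] at this
    | h0 => simp
    | hadd x y _ _ hx hy => rw [map_add]; exact add_mem hx hy
    | hsmul c x _ hx => rw [map_smul]; exact Submodule.smul_mem _ c hx
  | h0 => simp
  | hadd x y _ _ hx hy => rw [map_add, LinearMap.add_apply]; exact add_mem hx hy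
  | hsmul c x _ hx => rw [map_smul, LinearMap.smul_apply]; exact Submodule.smul_mem _ c hx

/-- The projection of `V[t, t⁻¹]` to its part of negative degree. -/
def loopNeg : (ℤ →₀ V) →ₗ[ℂ] (ℤ →₀ V) :=
  Finsupp.lsum ℂ fun m => letter m ∘ₗ A.extend fun k => if k - m - 1 < 0 then LinearMap.id else 0

theorem loopNeg_letter {k : ℤ} {u : V} (hu : u ∈ A.gr k) (m : ℤ) :
    A.loopNeg (letter m u) = if k - m - 1 < 0 then letter m u else 0 := by
  have h1 : A.loopNeg (letter m u) =
      letter m (A.extend (fun k => if k - m - 1 < 0 then LinearMap.id else 0) u) := by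
    simp [loopNeg, letter]
  rw [h1, A.extend_of_mem _ hu]
  split_ifs <;> simp

variable {X : Type*} [AddCommGroup X] [Module ℂ X]

/-- The linear map on `V[t, t⁻¹]` that is `u(wt u - 1) ↦ ψ u` in degree zero and zero in the
other degrees. -/
def loopZero (ψ : V →ₗ[ℂ] X) : (ℤ →₀ V) →ₗ[ℂ] X :=
  Finsupp.lsum ℂ fun m => A.extend fun k => if k - m - 1 = 0 then ψ else 0

theorem loopZero_letter (ψ : V →ₗ[ℂ] X) {k : ℤ} {u : V} (hu : u ∈ A.gr k) (m : ℤ) :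
    A.loopZero ψ (letter m u) = if k - m - 1 = 0 then ψ u else 0 := by
  have h1 : A.loopZero ψ (letter m u) =
      A.extend (fun k => if k - m - 1 = 0 then ψ else 0) u := by
    simp [loopZero, letter]
  rw [h1, A.extend_of_mem _ hu]
  split_ifs <;> simp

theorem loopZero_iterLetter (ψ : V →ₗ[ℂ] X) {α β : ℤ} {u v : V} (hu : u ∈ A.gr α)
    (hv : v ∈ A.gr β) (N : ℕ) (a m n : ℤ) : A.loopZero ψ (A.iterLetter N a m n u v) =
      if α + β - a - m - n - 2 = 0 then
        ∑ j ∈ range N, Ring.choose m j • ψ (A.mode (a + j) u v) else 0 := by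
  rw [iterLetter, map_sum]
  split_ifs with h
  · refine sum_congr rfl fun j _ => ?_
    rw [map_zsmul, A.loopZero_letter ψ (A.mode_mem hu hv _), if_pos (by omega)]
  · refine sum_eq_zero fun j _ => ?_
    rw [map_zsmul, A.loopZero_letter ψ (A.mode_mem hu hv _), if_neg (by omega), smul_zero]

/-- In total degree zero, α + β - n - 2 = m, so skew-symmetry modulo O(V) matches the coefficients
of the two brackets. -/
theorem loopZero_symm {ψ : V →ₗ[ℂ] X} (hψ : ∀ u ∈ A.zhuO, ψ u = 0) (x y : ℤ →₀ V) :
    A.loopZero ψ (A.bracket x y + A.bracket y x) = 0 := by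
  rw [map_add]
  induction x using A.letter_induction with
  | h α m u hu =>
    induction y using A.letter_induction with
    | h β n v hv =>
      set N := (α + β).toNat with hN
      rw [A.bracket_letter hu hv m n (N := N) (by omega),
        A.bracket_letter hv hu n m (N := N) (by omega), A.loopZero_iterLetter ψ hu hv,
        A.loopZero_iterLetter ψ hv hu]
      by_cases h : α + β - 0 - m - n - 2 = 0
      · rw [if_pos h, if_pos (by omega), A.map_sum_mode_swap hψ hu hv 0 n (by omega),
          Int.negOnePow_zero, Units.val_one, one_smul, show α + β - n - 0 - 2 = m by omega,
          add_neg_cancel]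
      · rw [if_neg h, if_neg (by omega), add_zero]
    | h0 => simp
    | hadd x y hx hy =>
      simp only [map_add, LinearMap.add_apply]
      rw [add_add_add_comm, hx, hy, add_zero]
  | h0 => simp
  | hadd x y hx hy =>
    simp only [map_add, LinearMap.add_apply]
    rw [add_add_add_comm, hx, hy, add_zero]

section

variable {A} {M : Type*} [AddCommGroup M] [Module ℂ M] (N : A.ZhuModule M)

/-- The action of representatives in `V` of elements of `A(V)`. -/
def ZhuModule.toEnd : V →ₗ[ℂ] Module.End ℂ M := N.ρ ∘ₗ A.zhuO.mkQ

theorem ZhuModule.toEnd_apply (u : V) : N.toEnd u = N.ρ (Submodule.Quotient.mk u) := rfl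

theorem ZhuModule.toEnd_of_mem : ∀ u ∈ A.zhuO, N.toEnd u = 0 := fun u hu => by
  rw [N.toEnd_apply, (Submodule.Quotient.mk_eq_zero _).2 hu, map_zero]

theorem ZhuModule.toEnd_zhuRes (u v : V) : N.toEnd (A.zhuRes (-1) u v) = N.toEnd u * N.toEnd v :=
  N.map_mul u v

/-- Zhu's commutator formula: skew-symmetry rewrites v * u with coefficients (α - 1 choose j), and
Pascal's rule reduces u * v - v * u to the sum of (α - 1 choose j) u_j v. -/
theorem ZhuModule.loopZero_bracket {x y : ℤ →₀ V} (hx : x ∈ A.loopGr 0) (hy : y ∈ A.loopGr 0) :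
    A.loopZero N.toEnd (A.bracket x y) = A.loopZero N.toEnd x * A.loopZero N.toEnd y -
      A.loopZero N.toEnd y * A.loopZero N.toEnd x := by
  induction hx using A.loopGr_induction with
  | h α m u hu hm =>
    induction hy using A.loopGr_induction with
    | h β n v hv hn =>
      set K := α.natAbs + β.natAbs with hK
      rw [A.bracket_letter hu hv m n (N := K) (by omega), A.loopZero_iterLetter _ hu hv,
        A.loopZero_letter _ hu, A.loopZero_letter _ hv, if_pos hm, if_pos hn, if_pos (by omega),
        ← N.toEnd_zhuRes, ← N.toEnd_zhuRes, A.zhuRes_of_mem hu (-1) v (N := K + 1) (by omega),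
        A.zhuRes_of_mem hv (-1) u (N := K + 1) (by omega)]
      simp only [map_sum, map_zsmul]
      rw [A.map_sum_mode_swap N.toEnd_of_mem hu hv (-1) β (by push_cast; omega),
        show α + β - β - (-1) - 2 = m by omega, show α = m + 1 by omega]
      simp only [Int.negOnePow_neg, Int.negOnePow_one, Units.val_neg, Units.val_one, neg_smul,
        one_smul, neg_neg]
      rw [sum_range_succ', sum_range_succ', add_sub_add_comm, ← sum_sub_distrib]
      simp only [Ring.choose_zero_right, sub_self, add_zero, Nat.cast_zero]
      refine sum_congr rfl fun j _ => ?_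
      rw [← sub_smul, Ring.choose_succ_succ, add_sub_cancel_right,
        show -1 + ((j + 1 : ℕ) : ℤ) = 0 + j by push_cast; ring]
    | h0 => simp
    | hadd x y _ _ hx hy => simp only [map_add, hx, hy, mul_add, add_mul]; abel
    | hsmul c x _ hx => simp only [map_smul, hx, mul_smul_comm, smul_mul_assoc, smul_sub]
  | h0 => simp
  | hadd x y _ _ hx hy => simp only [map_add, LinearMap.add_apply, hx, hy, mul_add, add_mul]; abel
  | hsmul c x _ hx =>
    simp only [map_smul, LinearMap.smul_apply, hx, mul_smul_comm, smul_mul_assoc, smul_sub]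

/-- The loop space of `V` with its bracket, acting on an `A(V)`-module in degree zero. -/
def ZhuModule.loop : TriangularLeibniz (ℤ →₀ V) M where
  br := A.bracket
  gr := A.loopGr
  neg := A.loopNeg
  rep := A.loopZero N.toEnd
  leibniz := A.bracket_leibniz
  iSup_gr := A.iSup_loopGr
  br_mem := A.bracket_mem
  neg_of_neg {a x} hx ha := by
    induction hx using A.loopGr_induction with
    | h k m u hu hk => rw [A.loopNeg_letter hu, if_pos (by omega)]
    | h0 => simp
    | hadd x y _ _ hx hy => rw [map_add, hx, hy]
    | hsmul c x _ hx => rw [map_smul, hx]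
  neg_of_nonneg {a x} hx ha := by
    induction hx using A.loopGr_induction with
    | h k m u hu hk => rw [A.loopNeg_letter hu, if_neg (by omega)]
    | h0 => simp
    | hadd x y _ _ hx hy => rw [map_add, hx, hy, add_zero]
    | hsmul c x _ hx => rw [map_smul, hx, smul_zero]
  rep_of_ne {a x} hx ha := by
    induction hx using A.loopGr_induction with
    | h k m u hu hk => rw [A.loopZero_letter _ hu, if_neg (by omega)]
    | h0 => simp
    | hadd x y _ _ hx hy => rw [map_add, hx, hy, add_zero]
    | hsmul c x _ hx => rw [map_smul, hx, smul_zero]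
  rep_symm := A.loopZero_symm N.toEnd_of_mem
  rep_br := N.loopZero_bracket

end

end NGradedVertexAlgebra

/-! ### Locally finite sums of operators -/

section LocallyFinite

open Finset

variable {W : Type*} [AddCommGroup W] [Module ℂ W]

/-- The sum of a locally finite family of operators. -/
def locallyFiniteSum (c : ℕ → Module.End ℂ W) (hc : ∀ f, ∃ K, ∀ i, K ≤ i → c i f = 0) :
    Module.End ℂ W :=
  have hfin : ∀ f, (Function.support fun i => c i f).Finite := fun f => by
    obtain ⟨K, hK⟩ := hc f
    refine (finite_toSet (range K)).subset fun i hi => ?_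
    by_contra hi'
    exact hi (hK i (by simpa using hi'))
  { toFun := fun f => ∑ᶠ i, c i f
    map_add' := fun f g => by
      rw [← finsum_add_distrib (hfin f) (hfin g)]
      simp only [map_add]
    map_smul' := fun r f => by
      simp only [map_smul, RingHom.id_apply]
      exact (smul_finsum r fun i => c i f).symm }

theorem locallyFiniteSum_apply {c : ℕ → Module.End ℂ W}
    (hc : ∀ f, ∃ K, ∀ i, K ≤ i → c i f = 0) {f : W} {K : ℕ} (hK : ∀ i, K ≤ i → c i f = 0) :
    locallyFiniteSum c hc f = ∑ i ∈ range K, c i f := by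
  change ∑ᶠ i, c i f = _
  refine finsum_eq_sum_of_support_subset _ fun i hi => ?_
  by_contra hi'
  exact hi (hK i (by simpa using hi'))

end LocallyFinite

/-! ### The Jacobi identity on the induced module -/

namespace NGradedVertexAlgebra

open Finset Filter

variable {V : Type*} [AddCommGroup V] [Module ℂ V] {A : NGradedVertexAlgebra V}
  {M : Type*} [AddCommGroup M] [Module ℂ M] (N : A.ZhuModule M)

/-- The graded module induced from the `A(V)`-module `M`. -/
abbrev ZhuModule.Induced : Type _ := N.loop.Induced

namespace ZhuModule

/-- The action of `u(m)` on the induced module. -/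
def op (m : ℤ) (u : V) : Module.End ℂ N.Induced := N.loop.act (letter m u)

theorem op_add (m : ℤ) (u v : V) : N.op m (u + v) = N.op m u + N.op m v := by
  rw [op, map_add, map_add, op, op]

theorem op_zero (m : ℤ) : N.op m 0 = 0 := by rw [op, map_zero, map_zero]

theorem op_eq_zero {a d m : ℤ} {u : V} (hu : u ∈ A.gr a) {f : N.Induced}
    (hf : f ∈ N.loop.homog d) (h : a - m - 1 + d < 0) : N.op m u f = 0 :=
  N.loop.act_eq_zero (A.letter_mem hu rfl) hf h

theorem op_mem_homog {a d : ℤ} {u : V} (hu : u ∈ A.gr a) {f : N.Induced}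
    (hf : f ∈ N.loop.homog d) (m : ℤ) : N.op m u f ∈ N.loop.homog (a - m - 1 + d) :=
  N.loop.act_mem_homog (A.letter_mem hu rfl) hf

theorem exists_op_eq_zero (u : V) (n : ℤ) (f : N.Induced) :
    ∃ K : ℕ, ∀ i : ℕ, K ≤ i → N.op (n + i) u f = 0 := by
  induction f using N.loop.homog_induction with
  | h d f hf =>
    induction u using A.gr_induction with
    | h a u hu =>
      refine ⟨(a - n + d).toNat, fun i hi => N.op_eq_zero hu hf (by omega)⟩
    | h0 => exact ⟨0, fun i _ => by rw [op_zero, LinearMap.zero_apply]⟩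
    | hadd x y hx hy =>
      obtain ⟨K, hK⟩ := hx
      obtain ⟨K', hK'⟩ := hy
      refine ⟨max K K', fun i hi => ?_⟩
      rw [op_add, LinearMap.add_apply, hK i (by omega), hK' i (by omega), add_zero]
  | h0 => exact ⟨0, fun i _ => map_zero _⟩
  | hadd x y hx hy =>
    obtain ⟨K, hK⟩ := hx
    obtain ⟨K', hK'⟩ := hy
    refine ⟨max K K', fun i hi => ?_⟩
    rw [map_add, hK i (by omega), hK' i (by omega), add_zero]

/-- The summands of `prodOp`. -/
def prodTerm (a m n : ℤ) (u v : V) (i : ℕ) : Module.End ℂ N.Induced :=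
  ((-1 : ℤ) ^ i * Ring.choose a i) • (N.op (m + a - i) u * N.op (n + i) v)

theorem prodTerm_apply (a m n : ℤ) (u v : V) (i : ℕ) (f : N.Induced) : N.prodTerm a m n u v i f =
    ((-1 : ℤ) ^ i * Ring.choose a i) • N.op (m + a - i) u (N.op (n + i) v f) := rfl

theorem prodTerm_eq_zero {a m n : ℤ} {u v : V} {i : ℕ} {f : N.Induced}
    (h : N.op (n + i) v f = 0) : N.prodTerm a m n u v i f = 0 := by
  rw [prodTerm_apply, h, map_zero, smul_zero]

theorem exists_prodTerm_eq_zero (a m n : ℤ) (u v : V) (f : N.Induced) :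
    ∃ K : ℕ, ∀ i : ℕ, K ≤ i → N.prodTerm a m n u v i f = 0 := by
  obtain ⟨K, hK⟩ := N.exists_op_eq_zero v n f
  exact ⟨K, fun i hi => N.prodTerm_eq_zero (hK i hi)⟩

/-- The operator `∑ᵢ (-1)^i (a choose i) u(m + a - i) v(n + i)`. -/
def prodOp (a m n : ℤ) (u v : V) : Module.End ℂ N.Induced :=
  locallyFiniteSum (N.prodTerm a m n u v) (N.exists_prodTerm_eq_zero a m n u v)

theorem prodOp_apply {a m n : ℤ} {u v : V} {f : N.Induced} {K : ℕ}
    (hK : ∀ i : ℕ, K ≤ i → N.op (n + i) v f = 0) :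
    N.prodOp a m n u v f = ∑ i ∈ range K, N.prodTerm a m n u v i f :=
  locallyFiniteSum_apply _ fun i hi => N.prodTerm_eq_zero (hK i hi)

theorem eventually_prodOp_apply (a m n : ℤ) (u v : V) (f : N.Induced) :
    ∀ᶠ K in atTop, N.prodOp a m n u v f = ∑ i ∈ range K, N.prodTerm a m n u v i f := by
  obtain ⟨K, hK⟩ := N.exists_op_eq_zero v n f
  filter_upwards [eventually_ge_atTop K] with K' hK'
  exact N.prodOp_apply fun i hi => hK i (hK'.trans hi)

theorem prodOp_zero (m n : ℤ) (u v : V) : N.prodOp 0 m n u v = N.op m u * N.op n v := by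
  refine LinearMap.ext fun f => ?_
  obtain ⟨K, hK, hK'⟩ := ((N.eventually_prodOp_apply 0 m n u v f).and (eventually_ge_atTop 1)).exists
  rw [hK, sum_eq_single_of_mem 0 (mem_range.2 hK')]
  · rw [prodTerm_apply, Ring.choose_zero_right]
    simp
  · intro i _ hi
    rw [prodTerm_apply, Ring.choose_zero_pos _ (Nat.pos_of_ne_zero hi), mul_zero, zero_smul]

theorem prodOp_succ (a m n : ℤ) (u v : V) :
    N.prodOp (a + 1) m n u v = N.prodOp a (m + 1) n u v - N.prodOp a m (n + 1) u v := by
  refine LinearMap.ext fun f => ?_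
  obtain ⟨K, hK⟩ := N.exists_op_eq_zero v n f
  rw [LinearMap.sub_apply, N.prodOp_apply (K := K + 1) fun i hi => hK i (by omega),
    N.prodOp_apply (K := K + 1) fun i hi => hK i (by omega),
    N.prodOp_apply (K := K) fun i hi => by
      rw [show n + 1 + (i : ℤ) = n + ((i + 1 : ℕ) : ℤ) by push_cast; ring]
      exact hK (i + 1) (by omega)]
  rw [sum_range_succ', sum_range_succ', add_sub_right_comm, ← sum_sub_distrib]
  simp only [prodTerm_apply, Ring.choose_zero_right]
  congr 1
  · refine sum_congr rfl fun i _ => ?_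
    rw [show m + (a + 1) - ((i + 1 : ℕ) : ℤ) = m + a - i by push_cast; ring,
      show m + 1 + a - ((i + 1 : ℕ) : ℤ) = m + a - i by push_cast; ring,
      show n + 1 + (i : ℤ) = n + ((i + 1 : ℕ) : ℤ) by push_cast; ring, ← sub_smul,
      Ring.choose_succ_succ]
    congr 1
    ring
  · rw [show m + (a + 1) = m + 1 + a by ring]

theorem op_op {γ α : ℤ} {z u : V} (hz : z ∈ A.gr γ) (hu : u ∈ A.gr α) (r m : ℤ) {K : ℕ}
    (hK : γ + α ≤ K) (f : N.Induced) : N.op r z (N.op m u f) = N.op m u (N.op r z f) +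
      ∑ k ∈ range K, Ring.choose r k • N.op (r + m - k) (A.mode k z u) f := by
  rw [op, op, N.loop.act_act]
  congr 1
  change N.loop.act (A.bracket _ _) f = _
  rw [A.bracket_letter hz hu r m hK, iterLetter, map_sum, LinearMap.sum_apply]
  simp only [map_zsmul, LinearMap.smul_apply, zero_add]
  rfl

/-- Commutators of `u(m)` with the products `prodOp`. -/
theorem op_mul_prodOp {α β γ : ℤ} {u v z : V} (hu : u ∈ A.gr α) (hv : v ∈ A.gr β)
    (hz : z ∈ A.gr γ) (r a m n : ℤ) {K : ℕ} (hα : γ + α ≤ K) (hβ : γ + β ≤ K) :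
    N.op r z * N.prodOp a m n u v = N.prodOp a m n u v * N.op r z +
      ∑ k ∈ range K, Ring.choose r k • (N.prodOp a (r + m - k) n (A.mode k z u) v +
        N.prodOp a m (r + n - k) u (A.mode k z v)) := by
  refine LinearMap.ext fun f => ?_
  have h1 : ∀ᶠ T in atTop, ∀ k ∈ range K, N.prodOp a (r + m - k) n (A.mode k z u) v f =
      ∑ i ∈ range T, N.prodTerm a (r + m - k) n (A.mode k z u) v i f :=
    (eventually_all_finset _).2 fun k _ => N.eventually_prodOp_apply _ _ _ _ _ _
  have h2 : ∀ᶠ T in atTop, ∀ k ∈ range K, N.prodOp a m (r + n - k) u (A.mode k z v) f =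
      ∑ i ∈ range T, N.prodTerm a m (r + n - k) u (A.mode k z v) i f :=
    (eventually_all_finset _).2 fun k _ => N.eventually_prodOp_apply _ _ _ _ _ _
  obtain ⟨T, h1, h2, h3, h4⟩ := (h1.and (h2.and ((N.eventually_prodOp_apply a m n u v f).and
    (N.eventually_prodOp_apply a m n u v (N.op r z f))))).exists
  rw [Module.End.mul_apply, LinearMap.add_apply, Module.End.mul_apply, h3, h4, map_sum,
    LinearMap.sum_apply]
  have h5 : ∀ k ∈ range K, (Ring.choose r k • (N.prodOp a (r + m - k) n (A.mode k z u) v +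
      N.prodOp a m (r + n - k) u (A.mode k z v))) f = ∑ i ∈ range T, Ring.choose r k •
        (N.prodTerm a (r + m - k) n (A.mode k z u) v i f +
          N.prodTerm a m (r + n - k) u (A.mode k z v) i f) := by
    intro k hk
    rw [LinearMap.smul_apply, LinearMap.add_apply, h1 k hk, h2 k hk, ← sum_add_distrib, smul_sum]
  rw [sum_congr rfl h5, sum_comm, ← sum_add_distrib]
  refine sum_congr rfl fun i _ => ?_
  simp only [prodTerm_apply]
  rw [map_zsmul, N.op_op hz hu r _ hα, N.op_op hz hv r _ hβ, map_add, map_sum]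
  simp only [smul_add, smul_sum, sum_add_distrib, map_zsmul]
  rw [add_assoc, add_comm (∑ _ ∈ _, _)]
  congr 2
  · refine sum_congr rfl fun k _ => ?_
    rw [smul_comm, show r + (m + a - i) - k = r + m - k + a - i by ring]
  · refine sum_congr rfl fun k _ => ?_
    rw [smul_comm, show r + (n + i) - k = r + n - k + i by ring]

/-- The difference of the two sides of the Jacobi identity. -/
def jacobiOp (T : ℕ) (a m n : ℤ) (u v : V) : Module.End ℂ N.Induced :=
  N.loop.act (A.iterLetter T a m n u v) -
    (N.prodOp a m n u v - (a.negOnePow : ℤ) • N.prodOp a n m v u)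

theorem jacobiOp_of_le {α β a : ℤ} {u v : V} (hu : u ∈ A.gr α) (hv : v ∈ A.gr β) (m n : ℤ)
    {T T' : ℕ} (hT : α + β ≤ a + T) (h : T ≤ T') :
    N.jacobiOp T' a m n u v = N.jacobiOp T a m n u v := by
  rw [jacobiOp, A.iterLetter_of_le hu hv m n hT h, jacobiOp]

theorem iterLetter_succ (A : NGradedVertexAlgebra V) (T : ℕ) (a m n : ℤ) (u v : V) :
    A.iterLetter T (a + 1) m n u v =
      A.iterLetter (T + 1) a (m + 1) n u v - A.iterLetter (T + 1) a m (n + 1) u v := by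
  rw [iterLetter, iterLetter, iterLetter, sum_range_succ', sum_range_succ', add_sub_add_comm,
    ← sum_sub_distrib]
  simp only [Ring.choose_zero_right]
  rw [show m + 1 + n = m + (n + 1) by ring, sub_self, add_zero]
  refine sum_congr rfl fun j _ => ?_
  rw [← sub_smul, Ring.choose_succ_succ, add_sub_cancel_right,
    show m + (n + 1) - ((j + 1 : ℕ) : ℤ) = m + n - j by push_cast; ring,
    show a + ((j + 1 : ℕ) : ℤ) = a + 1 + j by push_cast; ring]

/-- Multiplication by x₀ = x₁ - x₂, seen in components. -/
theorem jacobiOp_succ (T : ℕ) (a m n : ℤ) (u v : V) : N.jacobiOp T (a + 1) m n u v =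
    N.jacobiOp (T + 1) a (m + 1) n u v - N.jacobiOp (T + 1) a m (n + 1) u v := by
  rw [jacobiOp, jacobiOp, jacobiOp, iterLetter_succ, prodOp_succ, N.prodOp_succ a n m v u,
    Int.negOnePow_succ, map_sub, Units.val_neg, smul_sub, neg_smul, neg_smul]
  abel

theorem jacobiOp_zero {α β : ℤ} {u v : V} (hu : u ∈ A.gr α) (hv : v ∈ A.gr β) (m n : ℤ)
    {T : ℕ} (hT : α + β ≤ T) : N.jacobiOp T 0 m n u v = 0 := by
  rw [jacobiOp, prodOp_zero, prodOp_zero, ← A.bracket_letter hu hv m n hT, Int.negOnePow_zero,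
    Units.val_one, one_smul, op, op, N.loop.act_mul_sub]
  exact sub_self _

/-- Both sides of the Jacobi identity obey the same derivation rule under z(r), so defects at
exponent a are closed under commutators. -/
theorem op_mul_jacobiOp {α β γ : ℤ} {u v z : V} (hu : u ∈ A.gr α) (hv : v ∈ A.gr β)
    (hz : z ∈ A.gr γ) (r a m n : ℤ) {T : ℕ} (hα : γ + α ≤ T) (hβ : γ + β ≤ T)
    (h : γ + α + β ≤ a + T) :
    N.op r z * N.jacobiOp T a m n u v - N.jacobiOp T a m n u v * N.op r z =
      ∑ k ∈ range T, Ring.choose r k • (N.jacobiOp T a (r + m - k) n (A.mode k z u) v +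
        N.jacobiOp T a m (r + n - k) u (A.mode k z v)) := by
  have h1 : N.op r z * N.loop.act (A.iterLetter T a m n u v) =
      N.loop.act (A.iterLetter T a m n u v) * N.op r z + ∑ k ∈ range T, Ring.choose r k •
        (N.loop.act (A.iterLetter T a (r + m - k) n (A.mode k z u) v) +
          N.loop.act (A.iterLetter T a m (r + n - k) u (A.mode k z v))) := by
    have e := N.loop.act_mul_sub (letter r z) (A.iterLetter T a m n u v)
    change _ = N.loop.act (A.bracket _ _) at e
    rw [A.bracket_iterLetter hu hv hz r a m n hα h] at e
    simp only [map_sum, map_zsmul, map_add] at e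
    exact eq_add_of_sub_eq' e
  have h2 := N.op_mul_prodOp hu hv hz r a m n hα hβ
  have h3 := N.op_mul_prodOp hv hu hz r a n m hβ hα
  simp only [jacobiOp]
  rw [mul_sub, mul_sub, mul_smul_comm, h1, h2, h3, sub_mul, sub_mul, smul_mul_assoc]
  simp only [smul_add, smul_sub, sum_add_distrib, sum_sub_distrib, smul_sum]
  simp only [smul_comm (Ring.choose r _) (a.negOnePow : ℤ)]
  abel

theorem proj_act_word_nil (x : ℤ →₀ V) (w : M) :
    N.loop.proj (N.loop.act x (N.loop.word [] w)) = A.loopZero N.toEnd x w := by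
  rw [N.loop.act_word, N.loop.proj_apply, N.loop.word_apply, List.nil_append, N.loop.corr_cons,
    derSum_nil, N.loop.corr_nil, mul_one, add_zero]
  rfl

/-- Zhu's relations in `A(V)` are the Jacobi identity between vectors of `M`. -/
theorem proj_jacobiOp_word_nil_aux {α β : ℤ} {u v : V} (hu : u ∈ A.gr α) (hv : v ∈ A.gr β)
    {a : ℤ} (ha : a < 0) (n : ℤ) {T : ℕ} (hT : α + β ≤ a + T) (w : M) :
    N.loop.proj (N.jacobiOp T a α n u v (N.loop.word [] w)) = 0 := by
  have htop := N.loop.word_nil_mem_homog w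
  -- The cutoff is raised beyond α so that the iterate contains every term of `zhuRes`.
  rw [← N.jacobiOp_of_le hu hv α n hT (le_max_left T (α.toNat + 1))]
  generalize hT' : max T (α.toNat + 1) = T'
  have h1 : N.prodOp a n α v u (N.loop.word [] w) = 0 := by
    rw [N.prodOp_apply (K := 0) fun i _ => N.op_eq_zero hu htop (by omega), sum_range_zero]
  obtain ⟨K, hK, hK'⟩ := ((N.eventually_prodOp_apply a α n u v (N.loop.word [] w)).and
    (eventually_ge_atTop 1)).exists
  -- The letter u(α + a - i) has degree i - a - 1 ≥ 0, which is zero only for a = -1 and i = 0.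
  have h2 : ∀ (i : ℕ) (f : N.Induced), N.loop.proj (N.op (α + a - i) u f) =
      if a = -1 ∧ i = 0 then N.toEnd u (N.loop.proj f) else 0 := by
    intro i f
    rw [op, N.loop.proj_act_of_nonneg (A.letter_mem hu rfl) (by omega)]
    change A.loopZero N.toEnd _ _ = _
    rw [A.loopZero_letter _ hu]
    by_cases h : a = -1 ∧ i = 0
    · rw [if_pos h, if_pos (by omega)]
    · rw [if_neg h, if_neg (by omega), LinearMap.zero_apply]
  rw [jacobiOp, LinearMap.sub_apply, LinearMap.sub_apply, LinearMap.smul_apply, h1, smul_zero,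
    sub_zero, map_sub, proj_act_word_nil, A.loopZero_iterLetter _ hu hv, hK, map_sum,
    sum_eq_single_of_mem 0 (mem_range.2 hK')]
  · rw [prodTerm_apply, map_zsmul, h2, Ring.choose_zero_right, pow_zero, mul_one, one_smul, op,
      proj_act_word_nil, A.loopZero_letter _ hv, Nat.cast_zero, add_zero]
    have h3 : ∑ j ∈ range T', Ring.choose α j • N.toEnd (A.mode (a + j) u v) =
        N.toEnd (A.zhuRes a u v) := by
      rw [A.zhuRes_of_mem hu a v (N := T') (by omega), map_sum]
      simp only [map_zsmul]
    rw [h3]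
    rcases eq_or_ne a (-1) with rfl | ha1
    · rw [N.toEnd_zhuRes]
      by_cases h : β - n - 1 = 0
      · rw [if_pos (by omega), if_pos (by omega), if_pos h, Module.End.mul_apply, sub_self]
      · rw [if_neg (by omega), if_pos (by omega), if_neg h]
        simp
    · rw [N.toEnd_of_mem _ (Submodule.subset_span ⟨u, v, a, by omega, rfl⟩), ite_self,
        if_neg (by omega)]
      simp
  · intro i _ hi
    rw [prodTerm_apply, map_zsmul, h2, if_neg (by omega), smul_zero]

/-- Vanishing at a + 1 lets m and n be shifted against each other, which reduces everything to m =
α. -/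
theorem proj_jacobiOp_word_nil {α β : ℤ} {u v : V} (hu : u ∈ A.gr α) (hv : v ∈ A.gr β)
    {a : ℤ} (ha : a < 0) (hsucc : ∀ (m n : ℤ) (T : ℕ), α + β ≤ a + 1 + T →
      N.jacobiOp T (a + 1) m n u v = 0) (m n : ℤ) {T : ℕ} (hT : α + β ≤ a + T) (w : M) :
    N.loop.proj (N.jacobiOp T a m n u v (N.loop.word [] w)) = 0 := by
  have hshift : ∀ m n : ℤ, N.jacobiOp T a (m + 1) n u v = N.jacobiOp T a m (n + 1) u v := by
    intro m n
    have h := N.jacobiOp_succ T a m n u v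
    rw [hsucc m n T (by omega), N.jacobiOp_of_le hu hv _ _ hT (Nat.le_succ T),
      N.jacobiOp_of_le hu hv _ _ hT (Nat.le_succ T)] at h
    exact (sub_eq_zero.1 h.symm)
  have key : ∀ s n : ℤ, N.jacobiOp T a (α + s) n u v = N.jacobiOp T a α (n + s) u v := by
    intro s
    induction s using Int.induction_on with
    | zero => intro n; rw [add_zero, add_zero]
    | succ s ih => intro n; rw [← add_assoc, hshift, ih, add_right_comm, add_assoc]
    | pred s ih =>
      intro n
      have h := hshift (α + (-s - 1)) (n - 1)
      rw [show α + (-(s : ℤ) - 1) + 1 = α + -s by ring, sub_add_cancel, ih] at h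
      rw [← h]
      congr 1
      ring
  rw [show m = α + (m - α) by ring, key]
  exact N.proj_jacobiOp_word_nil_aux hu hv ha _ hT w

/-- The Jacobi identity holds on the induced module. -/
theorem jacobiOp_eq_zero (a : ℤ) : ∀ {α β : ℤ} {u v : V}, u ∈ A.gr α → v ∈ A.gr β →
    ∀ (m n : ℤ) (T : ℕ), α + β ≤ a + T → N.jacobiOp T a m n u v = 0 := by
  induction a using Int.induction_on with
  | zero => exact fun hu hv m n T hT => N.jacobiOp_zero hu hv m n (by omega)
  | succ a ih =>
    intro α β u v hu hv m n T hT
    rw [jacobiOp_succ, ih hu hv _ _ _ (by push_cast; omega), ih hu hv _ _ _ (by push_cast; omega),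
      sub_zero]
  | pred a ih =>
    intro α β u v hu hv m n T hT
    set b : ℤ := -(a : ℤ) - 1 with hb
    -- All u, v, m, n are taken at once: commutators replace u and v by z_k u and z_k v.
    let J : Submodule ℂ (Module.End ℂ N.Induced) := Submodule.span ℂ
      {j | ∃ (α β : ℤ) (u v : V) (m n : ℤ) (T : ℕ), u ∈ A.gr α ∧ v ∈ A.gr β ∧ α + β ≤ b + T ∧
        j = N.jacobiOp T b m n u v}
    refine N.loop.eq_zero_of_ad_stable J ?_ ?_ (Submodule.subset_span
      ⟨α, β, u, v, m, n, T, hu, hv, hT, rfl⟩)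
    · intro c x hx j hj
      induction hj using Submodule.span_induction with
      | mem j hj =>
        obtain ⟨α, β, u, v, m, n, T, hu, hv, hT, rfl⟩ := hj
        induction hx using A.loopGr_induction with
        | h γ r z hz hk =>
          set T' := T + (α.natAbs + β.natAbs + γ.natAbs) with hT'
          rw [← N.jacobiOp_of_le hu hv m n hT (T' := T') (by omega)]
          change N.op r z * _ - _ * N.op r z ∈ J
          rw [N.op_mul_jacobiOp hu hv hz r b m n (by omega) (by omega) (by omega)]
          refine Submodule.sum_mem _ fun k _ => zsmul_mem (add_mem ?_ ?_) _
          · exact Submodule.subset_span ⟨_, β, _, v, _, _, T', A.mode_mem hz hu k, hv, by omega, rfl⟩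
          · exact Submodule.subset_span ⟨α, _, u, _, _, _, T', hu, A.mode_mem hz hv k, by omega, rfl⟩
        | h0 =>
          rw [map_zero, zero_mul, mul_zero, sub_self]
          exact J.zero_mem
        | hadd x y _ _ hx hy =>
          rw [map_add, add_mul, mul_add, add_sub_add_comm]
          exact J.add_mem hx hy
        | hsmul c x _ hx =>
          rw [map_smul, smul_mul_assoc, mul_smul_comm, ← smul_sub]
          exact J.smul_mem c hx
      | zero => rw [mul_zero, zero_mul, sub_self]; exact J.zero_mem
      | add i j _ _ hi hj =>
        rw [mul_add, add_mul, add_sub_add_comm]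
        exact J.add_mem hi hj
      | smul c j _ hj =>
        rw [mul_smul_comm, smul_mul_assoc, ← smul_sub]
        exact J.smul_mem c hj
    · intro j hj w
      induction hj using Submodule.span_induction with
      | mem j hj =>
        obtain ⟨α, β, u, v, m, n, T, hu, hv, hT, rfl⟩ := hj
        refine N.proj_jacobiOp_word_nil hu hv (by omega) (fun m n T hT => ?_) m n hT w
        rw [show b + 1 = -(a : ℤ) by omega] at hT ⊢
        exact ih hu hv m n T hT
      | zero => simp
      | add i j _ _ hi hj => rw [LinearMap.add_apply, map_add, hi, hj, add_zero]
      | smul c j _ hj => rw [LinearMap.smul_apply, map_smul, hj, smul_zero]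

/-- Weak associativity: iterates of vertex operators as sums of products. -/
theorem act_iterLetter {α β d : ℤ} {u v : V} (hu : u ∈ A.gr α) (hv : v ∈ A.gr β)
    {f : N.Induced} (hf : f ∈ N.loop.homog d) (hl : 0 ≤ α + d) (a b : ℤ) {K : ℕ}
    (hK : β + d - b ≤ K) :
    N.loop.act (A.iterLetter (α + d + 1).toNat a (α + d) b u v) f =
      ∑ i ∈ range K, ((-1 : ℤ) ^ i * Ring.choose a i) •
        N.op (α + d + a - i) u (N.op (b + i) v f) := by
  set T := (α + d + 1).toNat + (α + β - a).toNat with hT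
  have h0 : A.iterLetter (α + d + 1).toNat a (α + d) b u v = A.iterLetter T a (α + d) b u v := by
    refine (sum_range_eq_of_le (fun j hj => ?_) (by omega)).symm
    rw [choose_eq_zero_of_lt hl (by omega), zero_smul]
  have h1 := LinearMap.congr_fun (N.jacobiOp_eq_zero a hu hv (α + d) b T (by omega)) f
  -- The letter u(α + d + i) sends f to degree -1 - i.
  have h2 : N.prodOp a b (α + d) v u f = 0 := by
    rw [N.prodOp_apply (K := 0) fun i _ => N.op_eq_zero hu hf (by omega), sum_range_zero]
  rw [jacobiOp, LinearMap.sub_apply, LinearMap.sub_apply, LinearMap.smul_apply, h2, smul_zero,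
    sub_zero, LinearMap.zero_apply, sub_eq_zero] at h1
  rw [h0, h1, N.prodOp_apply (K := K) fun i hi => N.op_eq_zero hv hf (by omega)]
  rfl

end ZhuModule

end NGradedVertexAlgebra

/-! ### The map from T(V[t, t⁻¹]) ⊗ M and the relations -/

namespace NGradedVertexAlgebra

open Finset

/-- The identification of `V ⊗ ℂ[t, t⁻¹]` with `ℤ →₀ V`. -/
def affToLoop (V : Type*) [AddCommGroup V] [Module ℂ V] :
    V ⊗[ℂ] LaurentPolynomial ℂ →ₗ[ℂ] (ℤ →₀ V) :=
  TensorProduct.lift (LinearMap.flip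
    ((Finsupp.lsum ℂ fun m => LinearMap.toSpanSingleton ℂ (V →ₗ[ℂ] (ℤ →₀ V)) (letter m)) ∘ₗ
      (AddMonoidAlgebra.coeffLinearEquiv ℂ).toLinearMap))

theorem affToLoop_tmul_T {V : Type*} [AddCommGroup V] [Module ℂ V] (u : V) (m : ℤ) :
    affToLoop V (u ⊗ₜ LaurentPolynomial.T m) = letter m u := by
  change Finsupp.lsum ℂ (fun m => LinearMap.toSpanSingleton ℂ (V →ₗ[ℂ] (ℤ →₀ V)) (letter m))
    (Finsupp.single m 1) u = _
  rw [Finsupp.lsum_single, LinearMap.toSpanSingleton_apply, one_smul]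

variable {V : Type*} [AddCommGroup V] [Module ℂ V] {A : NGradedVertexAlgebra V}
  {M : Type*} [AddCommGroup M] [Module ℂ M] (N : A.ZhuModule M)

namespace ZhuModule

/-- The action of the tensor algebra on the induced module. -/
def tensorAct : AffTensor V →ₐ[ℂ] Module.End ℂ N.Induced :=
  TensorAlgebra.lift ℂ (N.loop.act ∘ₗ affToLoop V)

theorem tensorAct_affGen (m : ℤ) (u : V) : N.tensorAct (affGen m u) = N.op m u := by
  rw [tensorAct, affGen, LinearMap.comp_apply, LinearMap.flip_apply, TensorProduct.mk_apply,
    TensorAlgebra.lift_ι_apply, LinearMap.comp_apply, affToLoop_tmul_T, op]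

/-- The canonical map from `T(V[t, t⁻¹]) ⊗ M` to the induced module. -/
def toInduced : AffTensor V ⊗[ℂ] M →ₗ[ℂ] N.Induced :=
  TensorProduct.lift
    (((LinearMap.lcomp ℂ N.Induced (N.loop.word [])) ∘ₗ N.tensorAct.toLinearMap))

theorem toInduced_tmul (X : AffTensor V) (w : M) :
    N.toInduced (X ⊗ₜ w) = N.tensorAct X (N.loop.word [] w) := rfl

theorem toInduced_one_tmul (w : M) : N.toInduced (1 ⊗ₜ w) = N.loop.word [] w := by
  rw [toInduced_tmul, _root_.map_one, Module.End.one_apply]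

theorem toInduced_smul (X : AffTensor V) (y : AffTensor V ⊗[ℂ] M) :
    N.toInduced (X • y) = N.tensorAct X (N.toInduced y) := by
  induction y using TensorProduct.induction_on with
  | zero => rw [smul_zero, map_zero, map_zero]
  | tmul Y w =>
    rw [TensorProduct.smul_tmul', smul_eq_mul, toInduced_tmul, toInduced_tmul, _root_.map_mul,
      Module.End.mul_apply]
  | add y z hy hz => rw [smul_add, map_add, hy, hz, map_add, map_add]

theorem toInduced_affGen_smul (m : ℤ) (u : V) (y : AffTensor V ⊗[ℂ] M) :
    N.toInduced (affGen m u • y) = N.op m u (N.toInduced y) := by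
  rw [toInduced_smul, tensorAct_affGen]

theorem toInduced_mem_homog {d : ℤ} {y : AffTensor V ⊗[ℂ] M} (hy : y ∈ A.degPart M d) :
    N.toInduced y ∈ N.loop.homog d := by
  induction hy using Submodule.span_induction with
  | mem y hy =>
    induction hy with
    | base w => rw [toInduced_one_tmul]; exact N.loop.word_nil_mem_homog w
    | cons d k m u x hu _ ih => rw [toInduced_affGen_smul]; exact N.op_mem_homog hu ih m
  | zero => rw [map_zero]; exact zero_mem _
  | add y z _ _ hy hz => rw [map_add]; exact add_mem hy hz
  | smul c y _ hy => rw [map_smul]; exact Submodule.smul_mem _ c hy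

theorem tensorAct_iterRes (a b l : ℤ) (u v : V) : N.tensorAct (A.iterRes a b l u v) =
    N.loop.act (A.iterLetter (l + 1).toNat a l b u v) := by
  rw [iterRes, iterLetter, map_sum, map_sum]
  refine sum_congr rfl fun j _ => ?_
  rw [map_zsmul, map_zsmul, tensorAct_affGen, op, show b + l - (j : ℤ) = l + b - j by ring]

theorem tensorAct_oT (u : V) (w : M) :
    N.tensorAct (A.oT u) (N.loop.word [] w) = N.loop.word [] (N.toEnd u w) := by
  induction u using A.gr_induction with
  | h a u hu =>
    rw [oT, A.extend_of_mem _ hu, tensorAct_affGen, op,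
      N.loop.act_word_nil_zero (A.letter_mem hu (by ring))]
    change N.loop.word [] (A.loopZero N.toEnd _ w) = _
    rw [A.loopZero_letter _ hu, if_pos (by ring)]
  | h0 => simp
  | hadd x y hx hy => simp only [map_add, LinearMap.add_apply, hx, hy]

/-- The kernel of the map to the induced module, as a submodule over the tensor algebra. -/
def kernel : Submodule (AffTensor V) (AffTensor V ⊗[ℂ] M) where
  carrier := {y | N.toInduced y = 0}
  zero_mem' := map_zero _
  add_mem' {y z} (hy : _ = _) (hz : _ = _) := show _ = _ by rw [map_add, hy, hz, add_zero]
  smul_mem' X y (hy : _ = _) := show _ = _ by rw [toInduced_smul, hy, map_zero]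

theorem mem_kernel {y : AffTensor V ⊗[ℂ] M} : y ∈ N.kernel ↔ N.toInduced y = 0 := Iff.rfl

/-- The iterate relations hold in the induced module, as finite sums of products. -/
theorem toInduced_iterRes_smul {α β d : ℤ} {u v : V} {w : AffTensor V ⊗[ℂ] M} (hu : u ∈ A.gr α)
    (hv : v ∈ A.gr β) (hw : w ∈ A.degPart M d) (a b : ℤ) {K : ℕ} (hK : β + d - b ≤ K) :
    N.toInduced (A.iterRes a b (α + d) u v • w) =
      ∑ i ∈ range K, ((-1 : ℤ) ^ i * Ring.choose a i) •
        N.op (α + d + a - i) u (N.op (b + i) v (N.toInduced w)) := by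
  have hf := N.toInduced_mem_homog hw
  rw [toInduced_smul, tensorAct_iterRes]
  rcases lt_or_ge (α + d) 0 with hl | hl
  -- For l < 0 the iterate is zero by convention. The products vanish too: either u has negative
  -- weight or w has negative degree.
  · have h0 : ∀ (i : ℕ), N.op (α + d + a - i) u (N.op (b + i) v (N.toInduced w)) = 0 := by
      intro i
      rcases lt_or_ge α 0 with hα | hα
      · rw [A.eq_zero_of_mem_gr hα hu, op_zero, LinearMap.zero_apply]
      · rw [N.loop.eq_zero_of_mem_homog (by omega) hf, map_zero, map_zero]
    rw [sum_eq_zero fun i _ => by rw [h0, smul_zero], iterLetter, Int.toNat_of_nonpos (by omega),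
      sum_range_zero, map_zero, LinearMap.zero_apply]
  · exact N.act_iterLetter hu hv hf hl a b hK

theorem truncRel_subset : A.truncRel M ⊆ N.kernel := by
  rintro _ ⟨a, d, m, u, w, hu, hw, h, rfl⟩
  rw [SetLike.mem_coe, mem_kernel, toInduced_affGen_smul]
  exact N.op_eq_zero hu (N.toInduced_mem_homog hw) h

theorem zhuRel_subset : zhuRel N ⊆ N.kernel := by
  rintro _ ⟨u, w, rfl⟩
  rw [SetLike.mem_coe, mem_kernel, map_sub, toInduced_smul, toInduced_one_tmul, toInduced_one_tmul,
    tensorAct_oT, toEnd_apply, sub_self]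

theorem choose_mul_choose_sub (r : ℤ) (i k : ℕ) :
    Ring.choose r i * Ring.choose (r - i) k = ((i + k).choose i : ℤ) * Ring.choose r (i + k) := by
  have := Ring.choose_smul_choose r (Nat.le_add_right i k)
  rw [nsmul_eq_mul, Nat.add_sub_cancel_left] at this
  exact this.symm

/-- Each iterate expands into products, and the terms with i + k = s share one product. Their
coefficients sum to (p - l choose s) ∑ (-1)^k (s choose k), which leaves only s = 0, that is
u(p)v(q)w. -/
theorem prodRel_subset : A.prodRel M ⊆ N.kernel := by
  rintro _ ⟨a, b, d, p, q, u, v, w, hu, hv, hw, hq, -, rfl⟩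
  set K := (b + d - q).toNat with hK
  set r := p - (a + d) with hr
  have hvan : ∀ i : ℕ, K ≤ i → N.op (q + i) v (N.toInduced w) = 0 := fun i hi =>
    N.op_eq_zero hv (N.toInduced_mem_homog hw) (by omega)
  rw [SetLike.mem_coe, mem_kernel, map_sub, map_sum, toInduced_affGen_smul, toInduced_affGen_smul,
    sub_eq_zero]
  have h1 : ∀ i ∈ range K, N.toInduced
      (Ring.choose r i • (A.iterRes (r - i) (q + i) (a + d) u v • w)) =
      ∑ k ∈ range K, ((-1 : ℤ) ^ k * ((i + k).choose i : ℤ) * Ring.choose r (i + k)) •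
        N.op (p - ((i + k : ℕ) : ℤ)) u (N.op (q + ((i + k : ℕ) : ℤ)) v (N.toInduced w)) := by
    intro i _
    rw [map_zsmul, N.toInduced_iterRes_smul hu hv hw _ _ (K := K) (by omega), smul_sum]
    refine sum_congr rfl fun k _ => ?_
    rw [← mul_smul, mul_left_comm, choose_mul_choose_sub, mul_assoc,
      show a + d + (r - i) - k = p - ((i + k : ℕ) : ℤ) by push_cast; omega,
      show q + (i : ℤ) + k = q + ((i + k : ℕ) : ℤ) by push_cast; ring]
  rw [sum_congr rfl h1, sum_range_sum_range_eq_sum_antidiagonal fun i k hik => by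
    rw [hvan _ hik, map_zero, smul_zero], sum_eq_single_of_mem 0 (mem_range.2 (by omega))]
  · simp
  · intro s _ hs
    have h2 : ∀ x ∈ antidiagonal s, ((-1 : ℤ) ^ x.2 * ((x.1 + x.2).choose x.1 : ℤ) *
        Ring.choose r (x.1 + x.2)) • N.op (p - ((x.1 + x.2 : ℕ) : ℤ)) u
          (N.op (q + ((x.1 + x.2 : ℕ) : ℤ)) v (N.toInduced w)) =
        (((-1 : ℤ) ^ x.2 * (s.choose x.2 : ℤ)) * Ring.choose r s) • N.op (p - (s : ℤ)) u
          (N.op (q + (s : ℤ)) v (N.toInduced w)) := by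
      intro x hx
      have hx' := mem_antidiagonal.1 hx
      rw [hx', Nat.choose_symm_of_eq_add hx'.symm]
    rw [sum_congr rfl h2, ← sum_smul, ← sum_mul]
    have h3 := Int.alternating_sum_range_choose_of_ne hs
    have h4 : ∑ x ∈ antidiagonal s, (-1 : ℤ) ^ x.2 * (s.choose x.2 : ℤ) = 0 := by
      rw [← Nat.sum_antidiagonal_swap]
      simp only [Prod.snd_swap]
      rw [Nat.sum_antidiagonal_eq_sum_range_succ fun i _ => (-1 : ℤ) ^ i * (s.choose i : ℤ)]
      exact h3
    rw [h4, zero_mul, zero_smul]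

theorem submoduleI_le : submoduleI N ≤ N.kernel :=
  Submodule.span_le.2 (Set.union_subset
    (Set.union_subset N.truncRel_subset N.zhuRel_subset) N.prodRel_subset)

theorem submoduleJ_le : submoduleJ N ≤ N.kernel.map (submoduleI N).mkQ := by
  refine Submodule.span_le.2 ?_
  rintro _ ⟨a, b, d, p, q, i, u, v, w, hu, hv, hw, hi, rfl⟩
  refine ⟨A.iterRes (p - (a + d) - i) (q + i) (a + d) u v • w, ?_, rfl⟩
  -- For i ≥ wt v + deg w - q every v(q + i + k) kills the image of w, so the empty sum `K = 0`
  -- suffices.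
  rw [SetLike.mem_coe, mem_kernel, N.toInduced_iterRes_smul hu hv hw _ _ (K := 0) (by omega),
    sum_range_zero]

/-- `M` embeds into the induced module. -/
theorem eq_zero_of_one_tmul_mem_kernel {w : M} (h : (1 : AffTensor V) ⊗ₜ[ℂ] w ∈ N.kernel) :
    w = 0 := by
  rw [mem_kernel, toInduced_one_tmul] at h
  rw [← N.loop.proj_word_nil w, h, map_zero]

end ZhuModule

end NGradedVertexAlgebra

end

/-! ### Conclusion -/

theorem theorem5p2 {V : Type*} [AddCommGroup V] [Module ℂ V] (A : NGradedVertexAlgebra V)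
    {M : Type*} [AddCommGroup M] [Module ℂ M] (N : A.ZhuModule M) :
    Function.Injective (NGradedVertexAlgebra.toS₁ N) ∧
      (NGradedVertexAlgebra.submoduleJ N : Set (NGradedVertexAlgebra.S₁ N)) ∩
        Set.range (NGradedVertexAlgebra.toS₁ N) = {0} := by
  constructor
  · intro w w' h
    have h1 := N.submoduleI_le ((Submodule.Quotient.eq _).1 h)
    rw [← TensorProduct.tmul_sub] at h1
    exact sub_eq_zero.1 (N.eq_zero_of_one_tmul_mem_kernel h1)
  · refine Set.eq_singleton_iff_unique_mem.2 ⟨⟨zero_mem _, 0, ?_⟩, ?_⟩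
    · rw [NGradedVertexAlgebra.toS₁, TensorProduct.tmul_zero, Submodule.Quotient.mk_zero]
    · rintro _ ⟨hJ, w, rfl⟩
      -- The vector 1 ⊗ w differs by an element of ℐ from some y in the kernel, so it lies in the
      -- kernel itself.
      obtain ⟨y, hy, hyw⟩ := N.submoduleJ_le hJ
      have h1 := N.submoduleI_le ((Submodule.Quotient.eq _).1 hyw)
      have h2 := N.kernel.sub_mem hy h1
      rw [sub_sub_cancel] at h2
      rw [N.eq_zero_of_one_tmul_mem_kernel h2, NGradedVertexAlgebra.toS₁, TensorProduct.tmul_zero,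
        Submodule.Quotient.mk_zero]
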